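/- **The model.** For every integer $j$ let $\lambda_{0,j},\lambda_{1,j},\delta_j,r_j\in[0,\infty)$, let $Z_j$ be a random variable in $\{1,2,\dots\}$, $C_j$ a random variable in $\{0,1,2,\dots\}$, and $B_j$ a probability law on $(0,\infty)$. The *PRP (preemptive-resume production) system* $Q=(Q(t))_{t\ge 0}$ started at $n_0\in\mathbb Z$ is the following integer-valued right-continuous process. At time $0$ customers with labels $n_0,n_0-1,n_0-2,\dots$ are present; $Q(t)$ is the label of the customer in service at time $t$, which is always the highest label present, so $Q(0)=n_0$. A customer who gets label $j$ brings an amount of work with law $B_j$, and the server works at speed $r_j$ while serving label $j$; all amounts of work are independent. While $Q=j$: * single arrivals occur at Poisson rate $\lambda_{0,j}$: a new customer gets label $j+1$ and $Q$ jumps to $j+1$; * batch arrivals occur at Poisson rate $\lambda_{1,j}$: $m$ new customers, $m$ distributed as $Z_j$, get the labels $j+1,\dots,j+m$ and $Q$ jumps to $j+m$; * catastrophes occur at Poisson rate $\delta_j$: $c$ customers, $c$ distributed as $C_j$, with labels $j,j-1,\dots,j-c+1$ are removed and $Q$ jumps to $j-c$; * when the work of customer $j$ is completed, this customer leaves and $Q$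 jumps to $j-1$. A customer whose service was interrupted resumes it later where it was left off. The Poisson processes, the batch and catastrophe sizes and the amounts of work are independent. (Equivalently, from each event on, fresh independent exponential clocks with rates $\lambda_{0,j},\lambda_{1,j},\delta_j$ compete with the completion of the residual work of customer $j$.) The *reflection* $Q_0$ of this system at level $0$ evolves in the same way, except that a catastrophe that would lead to a level $\le 0$ leads to level $0$, and that the server does not work while the process is at level $0$. **Theorem.** Let $n_0\ge 0$, let $Q$ be a PRP system with $Q(0)=n_0$, and let $Q_0$ be its reflection at level $0$, with $Q_0(0)=n_0$. Assume that for both systems almost surely only finitely many events occur in each bounded time interval. Let $e_q$ be an exponential random variable with rate $q>0$ that is independent of $Q$ (respectively, of $Q_0$). Then for all integers $l\ge 0$ and $k\ge 1$ with $P\bigl(\inf_{0\le u\le e_q}Q(u)=l\bigr)>0$, $$P\Bigl(Q(e_q)-\inf_{0\le u\le e_q}Q(u)=k\ \Big|\ \inf_{0\le u\le e_q}Q(u)=l\Bigr)=P\Bigl(Q_0(e_q)-\inf_{0\le u\le e_q}Q_0(u)=k\ \Big|\ \inf_{0\le u\le e_q}Q_0(u)=l\Bigr).$$ -/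

import Mathlib

open MeasureTheory ProbabilityTheory Filter Topology Set
open scoped NNReal ENNReal

noncomputable section

namespace PRP

/-- The parameters of a preemptive-resume production system whose levels (customer labels)
range over `ℤ`.  At level `j`: single arrivals have rate `singleRate j`; batch arrivals have rate
`batchRate j` and batch size law `batchSize j` (sizes at least one); catastrophes have rate
`catRate j` and remove a number of customers with law `catSize j`.  The customer with label `j`
brings a strictly positive amount of work with law `workLaw j`, and the server works at speed
`speed j` while it serves that customer. -/
structure Params where
  singleRate : ℤ → ℝ≥0
  batchRate : ℤ → ℝ≥0
  batchSize : ℤ → PMF ℕ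
  batchSize_zero : ∀ j, batchSize j 0 = 0
  catRate : ℤ → ℝ≥0
  catSize : ℤ → PMF ℕ
  workLaw : ℤ → ProbabilityMeasure ℝ≥0
  workLaw_zero : ∀ j, (workLaw j : Measure ℝ≥0) {0} = 0
  speed : ℤ → ℝ≥0

/-- The randomness consumed between two successive events of the system: three unit-rate
exponential clocks (single arrival, batch arrival, catastrophe), and, for every level, a batch
size, a catastrophe size and the amount of work of a customer that gets this label at the end of
the period.  Run at rate `r`, a unit-rate clock rings at the first point, after the last event, of a
Poisson process of rate `r`; the points of this process after that event do not depend on the past,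
so that fresh clocks may be used after each event.  The superposition, over the batch sizes `m`, of
independent Poisson processes with rates `batchRate j * batchSize j m` is a Poisson process of rate
`batchRate j` whose points carry independent marks with law `batchSize j`. -/
abbrev Innovation : Type :=
  ℝ × ℝ × ℝ × (ℤ → ℕ) × (ℤ → ℕ) × (ℤ → ℝ≥0)

namespace Innovation

/-- Unit-rate clock for single arrivals. -/
def singleClock (ξ : Innovation) : ℝ≥0∞ := ENNReal.ofReal ξ.1

/-- Unit-rate clock for batch arrivals. -/
def batchClock (ξ : Innovation) : ℝ≥0∞ := ENNReal.ofReal ξ.2.1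

/-- Unit-rate clock for catastrophes. -/
def catClock (ξ : Innovation) : ℝ≥0∞ := ENNReal.ofReal ξ.2.2.1

/-- Size of a batch that arrives at level `j`. -/
def batch (ξ : Innovation) (j : ℤ) : ℤ := (ξ.2.2.2.1 j : ℤ)

/-- Number of customers removed by a catastrophe at level `j`. -/
def removed (ξ : Innovation) (j : ℤ) : ℤ := (ξ.2.2.2.2.1 j : ℤ)

/-- Work of a newly arriving customer that gets label `i`. -/
def work (ξ : Innovation) (i : ℤ) : ℝ≥0∞ := (ξ.2.2.2.2.2 i : ℝ≥0∞)

end Innovation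

/-- The time after which an amount `w` (of work, or of a unit-rate clock) is used up at rate `r`;
it is infinite if `r = 0`. -/
def waitTime (w : ℝ≥0∞) (r : ℝ≥0) : ℝ≥0∞ := if r = 0 then ⊤ else w / r

/-- The system just after an event: the time of the event, the label of the customer in service,
and the residual amount of work of every customer that is present, that is, with label at most
`level` (the entries of `residual` above `level` are meaningless and are never read). -/
structure State where
  time : ℝ≥0∞
  level : ℤ
  residual : ℤ → ℝ≥0∞

/-- The rules of motion that distinguish a system from its reflection: the speed of the server at
each level, and the level actually reached by a catastrophe that would lead to a given level. -/
structure Rules where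
  speed : ℤ → ℝ≥0
  catTarget : ℤ → ℤ

namespace Params

variable (D : Params)

/-- The rules of the system itself. -/
def free : Rules where
  speed := D.speed
  catTarget := id

/-- The rules of the system reflected at level `b`: a catastrophe which would lead to a level at or
below `b` leads to `b`, and the server does not work at level `b`. -/
def reflected (b : ℤ) : Rules where
  speed := Function.update D.speed b 0
  catTarget := fun i => max b i

/-- The law of one innovation: all its components are independent. -/
def innovationLaw : Measure Innovation :=
  (expMeasure 1).prod <| (expMeasure 1).prod <| (expMeasure 1).prod <|
    (Measure.infinitePi fun j => (D.batchSize j).toMeasure).prod <|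
      (Measure.infinitePi fun j => (D.catSize j).toMeasure).prod <|
        Measure.infinitePi fun j => (D.workLaw j : Measure ℝ≥0)

/-- The time from the event that led to state `x` until the next event, which is the first among:
single arrival, batch arrival, catastrophe, and completion of the customer in service. -/
def holding (ρ : Rules) (x : State) (ξ : Innovation) : ℝ≥0∞ :=
  min (min (waitTime ξ.singleClock (D.singleRate x.level))
      (waitTime ξ.batchClock (D.batchRate x.level)))
    (min (waitTime ξ.catClock (D.catRate x.level))
      (waitTime (x.residual x.level) (ρ.speed x.level)))

/-- The residual amounts of work just before the next event: only the customer in service has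
received attention from the server. -/
def workBefore (ρ : Rules) (x : State) (ξ : Innovation) : ℤ → ℝ≥0∞ :=
  Function.update x.residual x.level
    (x.residual x.level - ρ.speed x.level * D.holding ρ x ξ)

/-- The state just after the next event.  An arrival preempts the customer in service, whose
residual work is kept; after a completion or a catastrophe the server resumes the work of the
customer with the highest remaining label.  If no further event happens, the new time is `⊤`. -/
def next (ρ : Rules) (x : State) (ξ : Innovation) : State :=
  let h := D.holding ρ x ξ
  let r := D.workBefore ρ x ξ
  if waitTime ξ.singleClock (D.singleRate x.level) = h then
    { time := x.time + h
      level := x.level + 1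
      residual := fun i => if x.level < i then ξ.work i else r i }
  else if waitTime ξ.batchClock (D.batchRate x.level) = h then
    { time := x.time + h
      level := x.level + ξ.batch x.level
      residual := fun i => if x.level < i then ξ.work i else r i }
  else if waitTime ξ.catClock (D.catRate x.level) = h then
    { time := x.time + h
      level := ρ.catTarget (x.level - ξ.removed x.level)
      residual := r }
  else
    { time := x.time + h
      level := x.level - 1
      residual := r }

end Params

/-- All the randomness of the system: the amounts of work of the customers present at time zero
(those with labels at most the initial level), and one innovation for each event. -/
abbrev Driver : Type := (ℤ → ℝ≥0) × (ℕ → Innovation)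

namespace Params

variable (D : Params)

/-- The law of the driving randomness: initial works and innovations are all independent. -/
def driverLaw : Measure Driver :=
  (Measure.infinitePi fun j => (D.workLaw j : Measure ℝ≥0)).prod
    (Measure.infinitePi fun _ : ℕ => D.innovationLaw)

/-- The state just after the `n`-th event, starting at time zero from level `n₀`. -/
def state (D : Params) (ρ : Rules) (n₀ : ℤ) (ω : Driver) : ℕ → State
  | 0 => { time := 0, level := n₀, residual := fun i => (ω.1 i : ℝ≥0∞) }
  | n + 1 => D.next ρ (state D ρ n₀ ω n) (ω.2 n)

/-- The level at time `t`, which is the level reached by the last event up to time `t`. -/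
def path (ρ : Rules) (n₀ : ℤ) (ω : Driver) (t : ℝ≥0) : ℤ :=
  (D.state ρ n₀ ω (sSup {n : ℕ | (D.state ρ n₀ ω n).time ≤ t})).level

/-- Almost surely only finitely many events happen in every bounded time interval, so that the
level process is well defined on the whole of `[0, ∞)`. -/
def NonExplosive (ρ : Rules) (n₀ : ℤ) : Prop :=
  ∀ᵐ ω ∂D.driverLaw, Tendsto (fun n => (D.state ρ n₀ ω n).time) atTop (𝓝 ⊤)

/-- The law of the level process started from level `n₀`, on the product `σ`-algebra. -/
def pathLaw (ρ : Rules) (n₀ : ℤ) : Measure (ℝ≥0 → ℤ) :=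
  D.driverLaw.map (D.path ρ n₀)

/-- `Q` is a level process with the given parameters and rules and with `Q 0 = n₀`: it has the law
described above, and its paths are right-continuous. -/
structure IsVersion (ρ : Rules) (n₀ : ℤ) {Ω : Type*} [MeasurableSpace Ω] (μ : Measure Ω)
    (Q : ℝ≥0 → Ω → ℤ) : Prop where
  hasLaw : HasLaw (fun ω t => Q t ω) (D.pathLaw ρ n₀) μ
  rightCont : ∀ᵐ ω ∂μ, ∀ t, ContinuousWithinAt (fun s => Q s ω) (Ici t) t

/-- `Q` is a PRP system with parameters `D` and `Q 0 = n₀`. -/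
def IsPRPSystem (n₀ : ℤ) {Ω : Type*} [MeasurableSpace Ω] (μ : Measure Ω)
    (Q : ℝ≥0 → Ω → ℤ) : Prop :=
  D.IsVersion D.free n₀ μ Q

/-- `Q` is the PRP system with parameters `D` reflected at level `b`, and `Q 0 = n₀`. -/
def IsReflectedPRPSystem (b n₀ : ℤ) {Ω : Type*} [MeasurableSpace Ω] (μ : Measure Ω)
    (Q : ℝ≥0 → Ω → ℤ) : Prop :=
  D.IsVersion (D.reflected b) n₀ μ Q

end Params

/-- The infimum of the path of `Q` over `[0, t]`. -/
def runningInf {Ω : Type*} (Q : ℝ≥0 → Ω → ℤ) (t : ℝ≥0) (ω : Ω) : ℤ :=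
  sInf ((fun u => Q u ω) '' Icc 0 t)

end PRP

end

/-! Drive both systems by the same randomness. As long as all levels are positive they use the same
clocks, sizes, works and speeds, so their paths coincide. For `l > 0` the events that enter the two
conditional probabilities are therefore almost surely equal under this coupling
(`killedLaw_levelEvent_pos`).

For `l = 0` the paths may differ: at level zero the reflected server rests, while the free one works
on a residual amount that depends on the past. The last visit to level zero before the exponential
time makes this difference harmless. Consider one period between events spent at level zero, and let
`y` be the time until the first of all other events, completion included. A clock of rate `r` and
the killing clock of rate `q` are the first to ring before `y` with probabilities in the ratio `r :
q`, whatever `y` is (`exp_clock_balance`). So an arrival of either kind opens an excursion with a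
probability proportional to that of being killed in the same period. The excursion is served with
fresh works and never looks at levels at or below zero; its law does not depend on the past or on
the rules there (`excursion_congr`). Summation over all periods at level zero gives P(level `k`,
minimum 0) = c_k · P(level 0, minimum 0), where c_k is `excursionRatio` for both systems
(`step_excursion`, `tsum_visits_eq`, `killedLaw_levelEvent_zero`). On normalisation the last factor,
the only one that sees the rules, cancels (`jointLaw_ratio_zero`).

An independent exponential time amounts to discounting. The process thus becomes the Markov chain of
states at events with discounted, killed one-step operators (`lintegral_chain`), and the
decomposition at the last visit to zero becomes a resolvent identity
(`tsum_iterate_killedStep_last_exit`). Two matters of regularity remain. Holding times are almost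
surely positive, so that the chain and the path visit the same levels. Value and infimum at a random
time are expressed by a set in the product `σ`-algebra (`levelSet`), which carries the result to
every right-continuous version. -/

noncomputable section

namespace PRP

/-! ### Exponential discounting -/

/-- The Laplace factor `exp (-r * a)`, with value `0` at `a = ⊤`. -/
def disc (r : ℝ) (a : ℝ≥0∞) : ℝ≥0∞ :=
  -- The value at `⊤` is set separately because `(⊤ : ℝ≥0∞).toReal = 0` would give 1.
  if a = ⊤ then 0 else ENNReal.ofReal (Real.exp (-(r * a.toReal)))

@[simp] lemma disc_top (r : ℝ) : disc r ⊤ = 0 := by simp [disc]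

@[simp] lemma disc_zero (r : ℝ) : disc r 0 = 1 := by simp [disc]

lemma disc_of_ne_top (r : ℝ) {a : ℝ≥0∞} (ha : a ≠ ⊤) :
    disc r a = ENNReal.ofReal (Real.exp (-(r * a.toReal))) := by simp [disc, ha]

lemma disc_add (r : ℝ) (a b : ℝ≥0∞) : disc r (a + b) = disc r a * disc r b := by
  by_cases ha : a = ⊤
  · simp [ha]
  by_cases hb : b = ⊤
  · simp [hb]
  rw [disc_of_ne_top r ha, disc_of_ne_top r hb, disc_of_ne_top r (by simp [ha, hb]),
    ENNReal.toReal_add ha hb, ← ENNReal.ofReal_mul (Real.exp_nonneg _), ← Real.exp_add]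
  congr 2
  ring

lemma disc_anti {r : ℝ} (hr : 0 ≤ r) : Antitone (disc r) := by
  intro a b hab
  by_cases hb : b = ⊤
  · simp [hb]
  have ha : a ≠ ⊤ := ne_top_of_le_ne_top hb hab
  rw [disc_of_ne_top r ha, disc_of_ne_top r hb]
  have := ENNReal.toReal_mono hb hab
  gcongr

lemma disc_le_one {r : ℝ} (hr : 0 ≤ r) (a : ℝ≥0∞) : disc r a ≤ 1 := by
  simpa using disc_anti hr (zero_le (a := a))

lemma measurable_disc (r : ℝ) : Measurable (disc r) := by
  unfold disc
  refine Measurable.ite (measurableSet_singleton _) measurable_const ?_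
  fun_prop

lemma noAtoms_expMeasure (r : ℝ) (s : ℝ) : expMeasure r {s} = 0 :=
  withDensity_absolutelyContinuous _ _ (by simp)

lemma expMeasure_Iic {r : ℝ} (hr : 0 < r) {x : ℝ} (hx : 0 ≤ x) :
    expMeasure r (Iic x) = ENNReal.ofReal (1 - Real.exp (-(r * x))) := by
  have := isProbabilityMeasure_expMeasure hr
  rw [← ofReal_cdf, cdf_expMeasure_eq hr, if_pos hx]

lemma ae_pos_expMeasure {r : ℝ} (hr : 0 < r) : ∀ᵐ s ∂expMeasure r, 0 < s := by
  rw [ae_iff]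
  have : {a : ℝ | ¬ 0 < a} = Iic 0 := by ext; simp
  rw [this, expMeasure_Iic hr le_rfl]
  simp

lemma expMeasure_le_add_disc {r : ℝ} (hr : 0 < r) (a : ℝ≥0∞) :
    expMeasure r {s | ENNReal.ofReal s ≤ a} + disc r a = 1 := by
  have := isProbabilityMeasure_expMeasure hr
  by_cases ha : a = ⊤
  · simp [ha]
  have : {s | ENNReal.ofReal s ≤ a} = Iic a.toReal := by
    ext s; simp [ENNReal.ofReal_le_iff_le_toReal ha]
  rw [this, expMeasure_Iic hr ENNReal.toReal_nonneg, disc_of_ne_top r ha,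
    ← ENNReal.ofReal_add _ (Real.exp_nonneg _)]
  · simp
  · simp only [sub_nonneg, Real.exp_le_one_iff]
    have := mul_nonneg hr.le (ENNReal.toReal_nonneg (a := a))
    linarith

lemma expMeasure_ge {r : ℝ} (hr : 0 < r) (a : ℝ≥0∞) :
    expMeasure r {s | a ≤ ENNReal.ofReal s} = disc r a := by
  have := isProbabilityMeasure_expMeasure hr
  have h1 : expMeasure r {s | a ≤ ENNReal.ofReal s} = expMeasure r {s | ENNReal.ofReal s ≤ a}ᶜ := by
    apply measure_congr
    -- The law has no atoms, so the boundary point may be dropped; negative `s`, which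
    -- `ENNReal.ofReal` sends to 0, form a null set.
    have h0 : ∀ᵐ s ∂expMeasure r, s ≠ a.toReal := by
      rw [ae_iff]
      simpa using noAtoms_expMeasure r a.toReal
    filter_upwards [h0, ae_pos_expMeasure hr] with s hs hs0
    simp only [eq_iff_iff]
    change (a ≤ ENNReal.ofReal s) ↔ ¬ (ENNReal.ofReal s ≤ a)
    rw [not_le]
    refine ⟨fun h => lt_of_le_of_ne h ?_, le_of_lt⟩
    rintro rfl
    exact hs (by rw [ENNReal.toReal_ofReal hs0.le])
  have hm : MeasurableSet {s | ENNReal.ofReal s ≤ a} :=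
    measurableSet_le ENNReal.measurable_ofReal measurable_const
  rw [h1, prob_compl_eq_one_sub hm, ← expMeasure_le_add_disc hr a]
  rw [ENNReal.add_sub_cancel_left (measure_ne_top _ _)]

/-- The exponential law as a measure on `ℝ≥0`. -/
def expNN (q : ℝ) : Measure ℝ≥0 := (expMeasure q).map Real.toNNReal

lemma isProbabilityMeasure_expNN {q : ℝ} (hq : 0 < q) : IsProbabilityMeasure (expNN q) := by
  have := isProbabilityMeasure_expMeasure hq
  exact Measure.isProbabilityMeasure_map measurable_real_toNNReal.aemeasurable

/-- The probabilistic meaning of `disc`: discounting at rate `q` is survival of an independent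
exponential clock. -/
lemma expNN_ge {q : ℝ} (hq : 0 < q) (a : ℝ≥0∞) : expNN q {t | a ≤ t} = disc q a := by
  rw [expNN, Measure.map_apply measurable_real_toNNReal, ← expMeasure_ge hq a]
  · rfl
  · exact measurableSet_le measurable_const measurable_coe_nnreal_ennreal

lemma expNN_Ico {q : ℝ} (hq : 0 < q) {a b : ℝ≥0∞} (hab : a ≤ b) :
    expNN q {t | a ≤ t ∧ t < b} = disc q a - disc q b := by
  have := isProbabilityMeasure_expNN hq
  have h : {t : ℝ≥0 | a ≤ t ∧ t < b} = {t : ℝ≥0 | a ≤ t} \ {t : ℝ≥0 | b ≤ t} := by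
    ext t; simp
  rw [h, measure_sdiff _ _ (measure_ne_top _ _), expNN_ge hq, expNN_ge hq]
  · exact fun t (ht : b ≤ t) => hab.trans ht
  · exact (measurableSet_le measurable_const measurable_coe_nnreal_ennreal).nullMeasurableSet

lemma measurable_waitTime (r : ℝ≥0) : Measurable fun w => waitTime w r := by
  unfold waitTime
  split_ifs
  · exact measurable_const
  · fun_prop

lemma disc_waitTime (q : ℝ) {r : ℝ≥0} (hr : r ≠ 0) (w : ℝ≥0∞) :
    disc q (waitTime w r) = disc (q / r) w := by
  have hr' : (r : ℝ≥0∞) ≠ 0 := by simpa using hr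
  rw [waitTime, if_neg hr]
  by_cases hw : w = ⊤
  · simp [hw, ENNReal.top_div]
  · have h2 : w / r ≠ ⊤ := ENNReal.div_ne_top hw hr'
    rw [disc_of_ne_top _ h2, disc_of_ne_top _ hw, ENNReal.toReal_div]
    congr 2
    simp
    ring

lemma waitTime_le_iff {r : ℝ≥0} (hr : r ≠ 0) (w y : ℝ≥0∞) :
    waitTime w r ≤ y ↔ w ≤ y * r := by
  rw [waitTime, if_neg hr, ENNReal.div_le_iff (by simpa using hr) (by simp)]

/-- Exponential tilting: the factor `exp (-r s)` turns the unit exponential density into a multiple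
of the density of rate `r + 1`. -/
lemma lintegral_disc_expMeasure {r : ℝ} (hr : 0 ≤ r) {A : Set ℝ} (hA : MeasurableSet A) :
    ENNReal.ofReal (r + 1) * ∫⁻ s in A, disc r (ENNReal.ofReal s) ∂expMeasure 1 =
      expMeasure (r + 1) A := by
  have hd : ∀ c : ℝ, expMeasure c = volume.withDensity (exponentialPDF c) := fun c => rfl
  have hm : ∀ c, Measurable (exponentialPDF c) := fun c =>
    (measurable_exponentialPDFReal c).ennreal_ofReal
  have hdm : Measurable fun s => disc r (ENNReal.ofReal s) :=
    (measurable_disc r).comp ENNReal.measurable_ofReal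
  rw [hd, hd, withDensity_apply _ hA, restrict_withDensity hA,
    lintegral_withDensity_eq_lintegral_mul _ (hm _) hdm, ← lintegral_const_mul _ ((hm _).mul hdm)]
  congr 1
  ext s
  simp only [Pi.mul_apply]
  rcases lt_or_ge s 0 with hs | hs
  · simp [exponentialPDF_of_neg hs]
  · rw [exponentialPDF_of_nonneg hs, exponentialPDF_of_nonneg hs,
      disc_of_ne_top _ ENNReal.ofReal_ne_top, ENNReal.toReal_ofReal hs,
      ← ENNReal.ofReal_mul (by positivity), ← ENNReal.ofReal_mul (by positivity)]
    congr 1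
    rw [one_mul, one_mul, ← Real.exp_add]
    congr 2
    ring

/-- Competition of an exponential clock of rate `r` and a killing clock of rate `q`, both stopped at
a fixed time `y`: the probabilities to ring first are in proportion to the rates. -/
lemma exp_clock_balance {q : ℝ} (hq : 0 < q) (r : ℝ≥0) (y : ℝ≥0∞) :
    ENNReal.ofReal q * ∫⁻ s in {s | waitTime (ENNReal.ofReal s) r ≤ y},
        disc q (waitTime (ENNReal.ofReal s) r) ∂expMeasure 1 =
      r * ∫⁻ s, (1 - disc q (min (waitTime (ENNReal.ofReal s) r) y)) ∂expMeasure 1 := by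
  have := isProbabilityMeasure_expMeasure one_pos
  by_cases hr : r = 0
  · simp [hr, waitTime]
  have hr0 : (0 : ℝ) < r := by positivity
  have hw : Measurable fun s => waitTime (ENNReal.ofReal s) r :=
    (measurable_waitTime r).comp ENNReal.measurable_ofReal
  set L : ℝ≥0∞ := y * r with hL
  set A : Set ℝ := {s | waitTime (ENNReal.ofReal s) r ≤ y} with hA
  have hA' : A = {s | ENNReal.ofReal s ≤ L} := by
    ext s; simp only [hA, mem_ofPred_eq, waitTime_le_iff hr, hL]
  have hAm : MeasurableSet A := measurableSet_le hw measurable_const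
  set I := ∫⁻ s in A, disc q (waitTime (ENNReal.ofReal s) r) ∂expMeasure 1 with hI
  set J := ∫⁻ s, (1 - disc q (min (waitTime (ENNReal.ofReal s) r) y)) ∂expMeasure 1 with hJ
  have hqr : 0 ≤ q / r := by positivity
  have h1 : ENNReal.ofReal (q / r + 1) * I + disc (q / r + 1) L = 1 := by
    rw [hI]
    simp_rw [disc_waitTime q hr]
    rw [lintegral_disc_expMeasure hqr hAm, hA', expMeasure_le_add_disc (by positivity)]
  -- On `Aᶜ` the clock is cut off at `y`. Since `L = y * r`, the exponent `(q / r + 1) * L` is `q *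
  -- y + L`, the discount at `y` and the tail of the clock beyond `L`.
  have hsplit : disc (q / r + 1) L = disc q y * expMeasure 1 Aᶜ := by
    have e1 : expMeasure 1 Aᶜ = disc 1 L := by
      have h := expMeasure_le_add_disc one_pos L
      rw [← hA'] at h
      rw [prob_compl_eq_one_sub hAm, ← h, ENNReal.add_sub_cancel_left (measure_ne_top _ _)]
    rw [e1]
    by_cases hy : y = ⊤
    · simp [hL, hy, hr]
    · have hLt : L ≠ ⊤ := ENNReal.mul_ne_top hy (by simp)
      rw [disc_of_ne_top _ hLt, disc_of_ne_top _ hLt, disc_of_ne_top _ hy,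
        ← ENNReal.ofReal_mul (Real.exp_nonneg _), ← Real.exp_add, hL, ENNReal.toReal_mul]
      congr 2
      simp
      field_simp
      ring
  have h2 : J + (I + disc q y * expMeasure 1 Aᶜ) = 1 := by
    have e2 : I + disc q y * expMeasure 1 Aᶜ =
        ∫⁻ s, disc q (min (waitTime (ENNReal.ofReal s) r) y) ∂expMeasure 1 := by
      rw [← lintegral_add_compl _ hAm]
      congr 1
      · refine setLIntegral_congr_fun hAm fun s hs => ?_
        rw [min_eq_left hs]
      · rw [← setLIntegral_const]
        refine setLIntegral_congr_fun hAm.compl fun s hs => ?_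
        rw [min_eq_right (le_of_lt (by simpa [hA] using hs))]
    have hmd : Measurable fun s => disc q (min (waitTime (ENNReal.ofReal s) r) y) :=
      (measurable_disc q).comp (hw.min measurable_const)
    rw [e2, hJ, ← lintegral_add_right _ hmd]
    simp [tsub_add_cancel_of_le (disc_le_one hq.le _)]
  rw [← hsplit] at h2
  have hIt : I ≠ ⊤ := by
    intro h; rw [h] at h2; simp at h2
  have hDt : disc (q / r + 1) L ≠ ⊤ := by
    intro h; rw [h] at h2; simp at h2
  -- `h1` and `h2` decompose the same total mass one; cancelling the common finite part leaves this
  -- proportion.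
  have h3 : ENNReal.ofReal (q / r) * I = J := by
    have e : ENNReal.ofReal (q / r) * I + (I + disc (q / r + 1) L) =
        J + (I + disc (q / r + 1) L) := by
      rw [h2, ← h1, ENNReal.ofReal_add hqr zero_le_one, ENNReal.ofReal_one]
      ring
    exact (ENNReal.add_left_inj (ENNReal.add_ne_top.2 ⟨hIt, hDt⟩)).1 e
  rw [← h3, ← mul_assoc, ← ENNReal.ofReal_coe_nnreal, ← ENNReal.ofReal_mul (by positivity)]
  congr 2
  field_simp

/-! ### Measurability of the dynamics -/

instance : MeasurableSpace State :=
  MeasurableSpace.comap (fun x : State => (x.time, x.level, x.residual)) inferInstance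

section Measurability

variable {α : Type*} [MeasurableSpace α]

lemma measurable_state_iff {f : α → State} :
    Measurable f ↔ Measurable (fun a => (f a).time) ∧ Measurable (fun a => (f a).level) ∧
      Measurable (fun a => (f a).residual) := by
  rw [measurable_comap_iff]
  exact ⟨fun h => ⟨h.fst, h.snd.fst, h.snd.snd⟩, fun h => h.1.prodMk (h.2.1.prodMk h.2.2)⟩

lemma measurable_time : Measurable State.time := (measurable_state_iff.1 measurable_id).1

lemma measurable_level : Measurable State.level := (measurable_state_iff.1 measurable_id).2.1

lemma measurable_residual : Measurable State.residual := (measurable_state_iff.1 measurable_id).2.2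

/-- The current level is a random index, and countability of `ℤ` makes evaluation there measurable.
-/
lemma measurable_eval_int {β : Type*} [MeasurableSpace β] {f : α → ℤ → β} {g : α → ℤ}
    (hf : Measurable f) (hg : Measurable g) : Measurable fun a => f a (g a) := by
  have h : Measurable fun p : (ℤ → β) × ℤ => p.1 p.2 :=
    measurable_from_prod_countable_left fun j => measurable_pi_apply j
  exact h.comp (hf.prodMk hg)

lemma measurable_waitTime_comp {f : α → ℝ≥0∞} {g : α → ℝ≥0} (hf : Measurable f)
    (hg : Measurable g) : Measurable fun a => waitTime (f a) (g a) := by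
  unfold waitTime
  exact Measurable.ite (hg (measurableSet_singleton 0)) measurable_const
    (hf.div hg.coe_nnreal_ennreal)

lemma measurable_singleClock : Measurable Innovation.singleClock := by
  unfold Innovation.singleClock; fun_prop

lemma measurable_batchClock : Measurable Innovation.batchClock := by
  unfold Innovation.batchClock; fun_prop

lemma measurable_catClock : Measurable Innovation.catClock := by
  unfold Innovation.catClock; fun_prop

lemma measurable_work (i : ℤ) : Measurable fun ξ : Innovation => ξ.work i := by
  unfold Innovation.work; fun_prop

lemma measurable_batch : Measurable Innovation.batch := by
  rw [measurable_pi_iff]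
  intro j
  unfold Innovation.batch
  have : Measurable fun ξ : Innovation => ξ.2.2.2.1 j := by fun_prop
  exact (measurable_of_countable _).comp this

lemma measurable_removed : Measurable Innovation.removed := by
  rw [measurable_pi_iff]
  intro j
  unfold Innovation.removed
  have : Measurable fun ξ : Innovation => ξ.2.2.2.2.1 j := by fun_prop
  exact (measurable_of_countable _).comp this

variable (D : Params) (ρ : Rules) {x : α → State} {ξ : α → Innovation}

lemma measurable_waitTime_singleClock (hx : Measurable x) (hξ : Measurable ξ) :
    Measurable fun a => waitTime (ξ a).singleClock (D.singleRate (x a).level) :=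
  measurable_waitTime_comp (measurable_singleClock.comp hξ)
    ((measurable_of_countable _).comp (measurable_level.comp hx))

lemma measurable_waitTime_batchClock (hx : Measurable x) (hξ : Measurable ξ) :
    Measurable fun a => waitTime (ξ a).batchClock (D.batchRate (x a).level) :=
  measurable_waitTime_comp (measurable_batchClock.comp hξ)
    ((measurable_of_countable _).comp (measurable_level.comp hx))

lemma measurable_waitTime_catClock (hx : Measurable x) (hξ : Measurable ξ) :
    Measurable fun a => waitTime (ξ a).catClock (D.catRate (x a).level) :=
  measurable_waitTime_comp (measurable_catClock.comp hξ)
    ((measurable_of_countable _).comp (measurable_level.comp hx))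

lemma measurable_holding (hx : Measurable x) (hξ : Measurable ξ) :
    Measurable fun a => D.holding ρ (x a) (ξ a) := by
  have hl := measurable_level.comp hx
  unfold Params.holding
  exact ((measurable_waitTime_singleClock D hx hξ).min (measurable_waitTime_batchClock D hx hξ)).min
    ((measurable_waitTime_catClock D hx hξ).min
      (measurable_waitTime_comp (measurable_eval_int (measurable_residual.comp hx) hl)
        ((measurable_of_countable _).comp hl)))

lemma measurable_workBefore (hx : Measurable x) (hξ : Measurable ξ) :
    Measurable fun a => D.workBefore ρ (x a) (ξ a) := by
  have hl : Measurable fun a => (x a).level := measurable_level.comp hx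
  have hr : Measurable fun a => (x a).residual := measurable_residual.comp hx
  have hs : Measurable fun a => ρ.speed (x a).level := (measurable_of_countable _).comp hl
  rw [measurable_pi_iff]
  intro i
  unfold Params.workBefore
  simp only [Function.update_apply]
  exact Measurable.ite (measurableSet_eq_fun measurable_const hl)
    ((measurable_eval_int hr hl).sub
      (hs.coe_nnreal_ennreal.mul (measurable_holding D ρ hx hξ)))
    ((measurable_pi_apply i).comp hr)

lemma measurable_next (hx : Measurable x) (hξ : Measurable ξ) :
    Measurable fun a => D.next ρ (x a) (ξ a) := by
  have hl : Measurable fun a => (x a).level := measurable_level.comp hx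
  have ht : Measurable fun a => (x a).time := measurable_time.comp hx
  have hh := measurable_holding D ρ hx hξ
  have hw := measurable_workBefore D ρ hx hξ
  have hnew : Measurable fun a i =>
      if (x a).level < i then (ξ a).work i else D.workBefore ρ (x a) (ξ a) i := by
    rw [measurable_pi_iff]
    intro i
    exact Measurable.ite (measurableSet_lt hl measurable_const)
      ((measurable_work i).comp hξ) ((measurable_pi_apply i).comp hw)
  have hb := measurable_eval_int (measurable_batch.comp hξ) hl
  have hc := measurable_eval_int (measurable_removed.comp hξ) hl
  unfold Params.next
  refine Measurable.ite (measurableSet_eq_fun (measurable_waitTime_singleClock D hx hξ) hh) ?_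
    (Measurable.ite (measurableSet_eq_fun (measurable_waitTime_batchClock D hx hξ) hh) ?_
      (Measurable.ite (measurableSet_eq_fun (measurable_waitTime_catClock D hx hξ) hh) ?_ ?_)) <;>
  refine measurable_state_iff.2 ⟨ht.add hh, ?_, ?_⟩
  · exact hl.add measurable_const
  · exact hnew
  · exact hl.add hb
  · exact hnew
  · exact (measurable_of_countable ρ.catTarget).comp (hl.sub hc)
  · exact hw
  · exact hl.sub measurable_const
  · exact hw

end Measurability

/-! ### The chain of states from an arbitrary initial state -/

/-- The state after `n` events, started in the state `x`. -/
def chain (D : Params) (ρ : Rules) (x : State) (ξ : ℕ → Innovation) : ℕ → State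
  | 0 => x
  | n + 1 => D.next ρ (chain D ρ x ξ n) (ξ n)

/-- Prepend a term to a sequence. -/
def seqCons {α : Type*} (p : α × (ℕ → α)) : ℕ → α
  | 0 => p.1
  | n + 1 => p.2 n

lemma measurable_seqCons {α : Type*} [MeasurableSpace α] : Measurable (seqCons (α := α)) := by
  rw [measurable_pi_iff]
  rintro (_ | n)
  · exact measurable_fst
  · exact (measurable_pi_apply n).comp measurable_snd

/-- An i.i.d. sequence stays i.i.d. with the same law when an independent term is put in front. It
suffices to compare cylinders. -/
lemma map_seqCons {α : Type*} [MeasurableSpace α] (ν : Measure α) [IsProbabilityMeasure ν] :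
    (ν.prod (Measure.infinitePi fun _ : ℕ => ν)).map seqCons =
      Measure.infinitePi fun _ : ℕ => ν := by
  apply Measure.eq_infinitePi
  intro s t ht
  rw [Measure.map_apply measurable_seqCons (MeasurableSet.pi s.countable_toSet fun i _ => ht i)]
  -- The index set is enlarged to an initial segment, with full sets in the new coordinates, so that
  -- the product splits into coordinate zero and a shifted product.
  obtain ⟨N, hN⟩ : ∃ N, s ⊆ Finset.range (N + 1) :=
    ⟨s.sup id, fun i hi => Finset.mem_range_succ_iff.2 (Finset.le_sup (f := id) hi)⟩
  set t' : ℕ → Set α := fun i => if i ∈ s then t i else univ with ht'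
  have h1 : seqCons ⁻¹' (Set.pi s t) =
      t' 0 ×ˢ (Set.pi (Finset.range N) fun i => t' (i + 1)) := by
    ext ⟨a, b⟩
    simp only [mem_preimage, Set.mem_pi, mem_prod, ht', Finset.mem_coe, Finset.mem_range]
    constructor
    · intro h
      refine ⟨?_, fun i _ => ?_⟩
      · split_ifs with h0
        · exact h 0 h0
        · trivial
      · split_ifs with h0
        · exact h (i + 1) h0
        · trivial
    · rintro ⟨h0, h⟩ (_ | i) hi
      · simpa [hi, seqCons] using h0
      · have := h i (by have := Finset.mem_range.1 (hN hi); omega)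
        simpa [hi, seqCons] using this
  have ht'm : ∀ i, MeasurableSet (t' i) := fun i => by
    simp only [ht']; split_ifs
    · exact ht i
    · exact MeasurableSet.univ
  rw [h1, Measure.prod_prod, Measure.infinitePi_pi _ fun i _ => ht'm (i + 1), mul_comm,
    ← Finset.prod_range_succ' (fun i => ν (t' i)) N]
  symm
  rw [← Finset.prod_subset hN]
  · exact Finset.prod_congr rfl fun i hi => by simp [ht', hi]
  · intro i _ hi
    simp [ht', hi]

lemma lintegral_seqCons {α : Type*} [MeasurableSpace α] (ν : Measure α) [IsProbabilityMeasure ν]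
    {f : (ℕ → α) → ℝ≥0∞} (hf : Measurable f) :
    ∫⁻ ξ, f ξ ∂(Measure.infinitePi fun _ : ℕ => ν) =
      ∫⁻ a, ∫⁻ ξ, f (seqCons (a, ξ)) ∂(Measure.infinitePi fun _ : ℕ => ν) ∂ν := by
  conv_lhs => rw [← map_seqCons ν]
  rw [lintegral_map hf measurable_seqCons]
  exact lintegral_prod _ (hf.comp measurable_seqCons).aemeasurable

section Chain

variable (D : Params) (ρ : Rules)

instance : IsProbabilityMeasure (expMeasure 1) := isProbabilityMeasure_expMeasure one_pos

instance (j : ℤ) : IsProbabilityMeasure (D.batchSize j).toMeasure :=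
  PMF.toMeasure.isProbabilityMeasure _

instance : IsProbabilityMeasure D.innovationLaw := by
  unfold Params.innovationLaw
  infer_instance

instance : IsProbabilityMeasure D.driverLaw := by
  unfold Params.driverLaw
  infer_instance

/-- The dynamics is homogeneous in the number of events. Together with `lintegral_seqCons` this
yields the Markov property at the first event. -/
lemma chain_seqCons_succ (x : State) (a : Innovation) (ξ : ℕ → Innovation) (n : ℕ) :
    chain D ρ x (seqCons (a, ξ)) (n + 1) = chain D ρ (D.next ρ x a) ξ n := by
  induction n with
  | zero => rfl
  | succ n ih =>
    rw [chain, ih]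
    rfl

lemma measurable_chain {α : Type*} [MeasurableSpace α] {x : α → State} {ξ : α → ℕ → Innovation}
    (hx : Measurable x) (hξ : Measurable ξ) (n : ℕ) :
    Measurable fun a => chain D ρ (x a) (ξ a) n := by
  induction n with
  | zero => exact hx
  | succ n ih => exact measurable_next D ρ ih ((measurable_pi_apply n).comp hξ)

/-- The initial state of the system with works `w`, at level `n₀`. -/
def initState (n₀ : ℤ) (w : ℤ → ℝ≥0) : State := { time := 0, level := n₀, residual := fun i => w i }

lemma measurable_initState (n₀ : ℤ) : Measurable (initState n₀) := by
  refine measurable_state_iff.2 ⟨measurable_const, measurable_const, ?_⟩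
  rw [measurable_pi_iff]
  intro i
  exact (measurable_pi_apply i).coe_nnreal_ennreal

lemma state_eq_chain (n₀ : ℤ) (ω : Driver) (n : ℕ) :
    D.state ρ n₀ ω n = chain D ρ (initState n₀ ω.1) ω.2 n := by
  induction n with
  | zero => rfl
  | succ n ih => rw [Params.state, chain, ih]

lemma measurable_state (n₀ : ℤ) (n : ℕ) : Measurable fun ω => D.state ρ n₀ ω n := by
  simp_rw [state_eq_chain]
  exact measurable_chain D ρ ((measurable_initState n₀).comp measurable_fst) measurable_snd n

lemma next_time (x : State) (a : Innovation) :
    (D.next ρ x a).time = x.time + D.holding ρ x a := by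
  unfold Params.next
  dsimp only
  split_ifs <;> rfl

end Chain

/-! ### Discounted transition operators -/

section Operators

variable (D : Params) (ρ : Rules) (q : ℝ)

/-- One step of the chain of states, discounted by the length of the step. -/
def step (f : State → ℝ≥0∞) (x : State) : ℝ≥0∞ :=
  ∫⁻ ξ, disc q (D.holding ρ x ξ) * f (D.next ρ x ξ) ∂D.innovationLaw

/-- One discounted step of the chain, killed outside the levels in `A`. -/
def killedStep (A : Set ℤ) (f : State → ℝ≥0∞) : State → ℝ≥0∞ :=
  indicator (State.level ⁻¹' A) (step D ρ q f)

/-- The probability that a clock of rate `q` rings before the next event. -/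
def ringProb (x : State) : ℝ≥0∞ :=
  ∫⁻ ξ, (1 - disc q (D.holding ρ x ξ)) ∂D.innovationLaw

variable {D ρ q}

lemma measurable_preimage_level (A : Set ℤ) : MeasurableSet (State.level ⁻¹' A) :=
  measurable_level (MeasurableSet.of_discrete)

lemma measurable_disc_holding :
    Measurable fun p : State × Innovation => disc q (D.holding ρ p.1 p.2) :=
  (measurable_disc q).comp (measurable_holding D ρ measurable_fst measurable_snd)

lemma measurable_step_integrand {f : State → ℝ≥0∞} (hf : Measurable f) :
    Measurable fun p : State × Innovation =>
      disc q (D.holding ρ p.1 p.2) * f (D.next ρ p.1 p.2) :=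
  measurable_disc_holding.mul (hf.comp (measurable_next D ρ measurable_fst measurable_snd))

lemma measurable_step_integrand_right {f : State → ℝ≥0∞} (hf : Measurable f) (x : State) :
    Measurable fun ξ => disc q (D.holding ρ x ξ) * f (D.next ρ x ξ) :=
  ((measurable_disc q).comp (measurable_holding D ρ measurable_const measurable_id)).mul
    (hf.comp (measurable_next D ρ measurable_const measurable_id))

lemma measurable_step {f : State → ℝ≥0∞} (hf : Measurable f) : Measurable (step D ρ q f) :=
  (measurable_step_integrand hf).lintegral_prod_right'

lemma measurable_killedStep (A : Set ℤ) {f : State → ℝ≥0∞} (hf : Measurable f) :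
    Measurable (killedStep D ρ q A f) :=
  (measurable_step hf).indicator (measurable_preimage_level A)

lemma measurable_iterate_killedStep (A : Set ℤ) {f : State → ℝ≥0∞} (hf : Measurable f) (n : ℕ) :
    Measurable ((killedStep D ρ q A)^[n] f) := by
  induction n with
  | zero => exact hf
  | succ n ih => rw [Function.iterate_succ_apply']; exact measurable_killedStep A ih

lemma measurable_ringProb : Measurable (ringProb D ρ q) :=
  (measurable_const.sub measurable_disc_holding).lintegral_prod_right'

lemma step_add {f g : State → ℝ≥0∞} (hf : Measurable f) :
    step D ρ q (f + g) = step D ρ q f + step D ρ q g := by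
  ext x
  simp only [step, Pi.add_apply, mul_add]
  exact lintegral_add_left (measurable_step_integrand_right hf x) _

lemma step_const_mul (c : ℝ≥0∞) {f : State → ℝ≥0∞} (hf : Measurable f) :
    step D ρ q (fun x => c * f x) = fun x => c * step D ρ q f x := by
  ext x
  simp only [step]
  rw [← lintegral_const_mul _ (measurable_step_integrand_right hf x)]
  congr 1 with ξ
  ring

lemma step_tsum {f : ℕ → State → ℝ≥0∞} (hf : ∀ n, Measurable (f n)) :
    step D ρ q (fun x => ∑' n, f n x) = fun x => ∑' n, step D ρ q (f n) x := by
  ext x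
  simp only [step, ← ENNReal.tsum_mul_left]
  exact lintegral_tsum fun n => (measurable_step_integrand_right (hf n) x).aemeasurable

lemma killedStep_add (A : Set ℤ) {f g : State → ℝ≥0∞} (hf : Measurable f) :
    killedStep D ρ q A (f + g) = killedStep D ρ q A f + killedStep D ρ q A g := by
  rw [killedStep, step_add hf, killedStep, killedStep, ← indicator_add']

lemma killedStep_const_mul (A : Set ℤ) (c : ℝ≥0∞) {f : State → ℝ≥0∞} (hf : Measurable f) :
    killedStep D ρ q A (fun x => c * f x) = fun x => c * killedStep D ρ q A f x := by
  ext x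
  rw [killedStep, step_const_mul c hf, killedStep]
  by_cases h : x ∈ State.level ⁻¹' A <;> simp [h]

lemma killedStep_tsum (A : Set ℤ) {f : ℕ → State → ℝ≥0∞} (hf : ∀ n, Measurable (f n)) :
    killedStep D ρ q A (fun x => ∑' n, f n x) = fun x => ∑' n, killedStep D ρ q A (f n) x := by
  ext x
  simp only [killedStep, step_tsum hf]
  by_cases h : x ∈ State.level ⁻¹' A <;> simp [h]

lemma iterate_killedStep_add (A : Set ℤ) {f g : State → ℝ≥0∞} (hf : Measurable f) (n : ℕ) :
    (killedStep D ρ q A)^[n] (f + g) = (killedStep D ρ q A)^[n] f + (killedStep D ρ q A)^[n] g := by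
  induction n with
  | zero => rfl
  | succ n ih =>
    simp only [Function.iterate_succ_apply']
    rw [ih, killedStep_add A (measurable_iterate_killedStep A hf n)]

lemma iterate_killedStep_const_mul (A : Set ℤ) (c : ℝ≥0∞) {f : State → ℝ≥0∞} (hf : Measurable f)
    (n : ℕ) :
    (killedStep D ρ q A)^[n] (fun x => c * f x) = fun x => c * (killedStep D ρ q A)^[n] f x := by
  induction n with
  | zero => rfl
  | succ n ih =>
    simp only [Function.iterate_succ_apply']
    rw [ih, killedStep_const_mul A c (measurable_iterate_killedStep A hf n)]

lemma iterate_killedStep_tsum (A : Set ℤ) {f : ℕ → State → ℝ≥0∞} (hf : ∀ n, Measurable (f n))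
    (n : ℕ) :
    (killedStep D ρ q A)^[n] (fun x => ∑' j, f j x) =
      fun x => ∑' j, (killedStep D ρ q A)^[n] (f j) x := by
  induction n with
  | zero => rfl
  | succ n ih =>
    simp only [Function.iterate_succ_apply']
    rw [ih, killedStep_tsum A fun j => measurable_iterate_killedStep A (hf j) n]

lemma killedStep_union {A B : Set ℤ} (hAB : Disjoint A B) (f : State → ℝ≥0∞) :
    killedStep D ρ q (A ∪ B) f = killedStep D ρ q A f + killedStep D ρ q B f := by
  rw [killedStep, preimage_union, indicator_union_of_disjoint (hAB.preimage _)]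
  rfl

/-- Decomposition of the visits at time `n + 1` according to the last visit to the levels in `B`. -/
lemma iterate_killedStep_last_exit {A B : Set ℤ} (hAB : Disjoint A B) (n : ℕ) {f : State → ℝ≥0∞}
    (hf : Measurable f) (x : State) :
    (killedStep D ρ q (A ∪ B))^[n + 1] f x =
      (killedStep D ρ q A)^[n + 1] f x + ∑ p ∈ Finset.HasAntidiagonal.antidiagonal n,
        (killedStep D ρ q (A ∪ B))^[p.1] (killedStep D ρ q B ((killedStep D ρ q A)^[p.2] f)) x := by
  induction n generalizing f with
  | zero => simp [killedStep_union hAB]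
  | succ n ih =>
    -- The innermost operator, which acts at the latest time, is split. Its `A`-part is covered by
    -- the induction hypothesis for `killedStep D ρ q A f`; its `B`-part is the new antidiagonal
    -- term `(n + 1, 0)`.
    rw [Function.iterate_succ_apply, killedStep_union hAB,
      iterate_killedStep_add _ (measurable_killedStep A hf), Pi.add_apply,
      ih (measurable_killedStep A hf), ← Function.iterate_succ_apply,
      Finset.Nat.antidiagonal_succ']
    simp only [Finset.sum_cons, Finset.sum_map, Function.Embedding.coe_prodMap,
      ← Function.iterate_succ_apply,
      Function.iterate_zero_apply, Prod.map]
    rw [add_assoc, add_comm (∑ _ ∈ _, _)]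
    rfl

/-- With `G` the sum of all iterates of `killedStep`, `K`, this is the resolvent identity `G_{A ∪ B}
= G_A + G_{A ∪ B} K_B G_A`. All terms are nonnegative, so rearranging the series needs no
convergence condition. -/
lemma tsum_iterate_killedStep_last_exit {A B : Set ℤ} (hAB : Disjoint A B) {f : State → ℝ≥0∞}
    (hf : Measurable f) (x : State) :
    ∑' n, (killedStep D ρ q (A ∪ B))^[n] f x =
      ∑' n, (killedStep D ρ q A)^[n] f x +
        ∑' n, (killedStep D ρ q (A ∪ B))^[n]
          (killedStep D ρ q B fun y => ∑' j, (killedStep D ρ q A)^[j] f y) x := by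
  have h3 : ∀ n, (killedStep D ρ q (A ∪ B))^[n]
      (killedStep D ρ q B fun y => ∑' j, (killedStep D ρ q A)^[j] f y) x =
      ∑' j, (killedStep D ρ q (A ∪ B))^[n]
        (killedStep D ρ q B ((killedStep D ρ q A)^[j] f)) x := fun n => by
    rw [killedStep_tsum B fun j => measurable_iterate_killedStep A hf j,
      iterate_killedStep_tsum _ fun j =>
        measurable_killedStep B (measurable_iterate_killedStep A hf j)]
  simp_rw [h3]
  -- The terms of index zero agree; those of index `n + 1` are grouped along antidiagonals as in a
  -- Cauchy product.
  rw [tsum_eq_zero_add' ENNReal.summable,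
    tsum_eq_zero_add' (f := fun n => (killedStep D ρ q A)^[n] f x) ENNReal.summable]
  simp_rw [iterate_killedStep_last_exit hAB _ hf]
  rw [ENNReal.tsum_add, ← ENNReal.tsum_prod,
    ← Finset.HasAntidiagonal.sigmaAntidiagonalEquivProd.tsum_eq,
    ENNReal.tsum_sigma', ← add_assoc]
  congr 1
  refine tsum_congr fun n => ?_
  rw [tsum_fintype, ← Finset.sum_coe_sort]
  rfl

/-- The Markov property, for a functional of the state and the innovation at the `n`-th event. -/
lemma lintegral_chain (A : Set ℤ) {g : State → Innovation → ℝ≥0∞}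
    (hg : Measurable (Function.uncurry g)) (n : ℕ) (x : State) :
    ∫⁻ ξ, indicator {ξ | ∀ i < n, (chain D ρ x ξ i).level ∈ A}
        (fun ξ => disc q (chain D ρ x ξ n).time * g (chain D ρ x ξ n) (ξ n)) ξ
        ∂(Measure.infinitePi fun _ : ℕ => D.innovationLaw) =
      disc q x.time *
        (killedStep D ρ q A)^[n] (fun y => ∫⁻ ξ, g y ξ ∂D.innovationLaw) x := by
  have hch : ∀ (y : State) n, Measurable fun ξ => chain D ρ y ξ n := fun y n =>
    measurable_chain D ρ measurable_const measurable_id n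
  have hset : ∀ (y : State) n, MeasurableSet {ξ | ∀ i < n, (chain D ρ y ξ i).level ∈ A} := by
    intro y n
    simp only [ofPred_forall]
    exact MeasurableSet.iInter fun i => MeasurableSet.iInter fun _ =>
      (hch y i) (measurable_preimage_level A)
  have hmeas : ∀ (y : State) n, Measurable (indicator {ξ | ∀ i < n, (chain D ρ y ξ i).level ∈ A}
      (fun ξ => disc q (chain D ρ y ξ n).time * g (chain D ρ y ξ n) (ξ n))) := by
    intro y n
    refine Measurable.indicator ?_ (hset y n)
    exact ((measurable_disc q).comp (measurable_time.comp (hch y n))).mul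
      (hg.comp ((hch y n).prodMk (measurable_pi_apply n)))
  -- The first innovation is split off before the induction, so that the hypothesis can be used for
  -- the state reached after it.
  rw [lintegral_seqCons _ (hmeas x n)]
  induction n generalizing x with
  | zero =>
    have hgx : Measurable (g x) := hg.comp measurable_prodMk_left
    simp [chain, seqCons, lintegral_const_mul _ hgx]
  | succ n ih =>
    rw [Function.iterate_succ_apply']
    by_cases hx : x.level ∈ A
    · have h1 : ∀ a ξ, indicator {ξ | ∀ i < n + 1, (chain D ρ x ξ i).level ∈ A}
          (fun ξ => disc q (chain D ρ x ξ (n + 1)).time * g (chain D ρ x ξ (n + 1)) (ξ (n + 1)))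
            (seqCons (a, ξ)) =
          indicator {ξ | ∀ i < n, (chain D ρ (D.next ρ x a) ξ i).level ∈ A}
          (fun ξ => disc q (chain D ρ (D.next ρ x a) ξ n).time *
            g (chain D ρ (D.next ρ x a) ξ n) (ξ n)) ξ := by
        intro a ξ
        have h2 : seqCons (a, ξ) ∈ {ξ | ∀ i < n + 1, (chain D ρ x ξ i).level ∈ A} ↔
            ξ ∈ {ξ | ∀ i < n, (chain D ρ (D.next ρ x a) ξ i).level ∈ A} := by
          constructor
          · intro h i hi
            have := h (i + 1) (by omega)
            rwa [chain_seqCons_succ] at this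
          · rintro h (_ | i) hi
            · exact hx
            · rw [chain_seqCons_succ]
              exact h i (by omega)
        by_cases h3 : ξ ∈ {ξ | ∀ i < n, (chain D ρ (D.next ρ x a) ξ i).level ∈ A}
        · rw [indicator_of_mem (h2.2 h3), indicator_of_mem h3, chain_seqCons_succ]
          rfl
        · rw [indicator_of_notMem (fun h => h3 (h2.1 h)), indicator_of_notMem h3]
      simp_rw [h1]
      have h4 : ∀ a, _ := fun a => (lintegral_seqCons _ (hmeas (D.next ρ x a) n)).trans
        (ih (D.next ρ x a))
      simp_rw [h4]
      -- The discount up to the new state is the old discount times that of the holding time,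
      -- because `disc` is multiplicative.
      rw [killedStep, indicator_of_mem (by exact hx), step, ← lintegral_const_mul]
      · congr 1 with a
        rw [next_time, disc_add]
        ring
      · exact measurable_step_integrand_right
          (measurable_iterate_killedStep A hg.lintegral_prod_right n) x
    · rw [killedStep, indicator_of_notMem (by exact hx), mul_zero]
      have h1 : ∀ a ξ, seqCons (a, ξ) ∉ {ξ | ∀ i < n + 1, (chain D ρ x ξ i).level ∈ A} :=
        fun a ξ h => hx (h 0 (by omega))
      simp only [indicator_of_notMem (h1 _ _), lintegral_zero]

end Operators

/-! ### Excursions above level zero -/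

lemma ae_waitTime_ne (r : ℝ≥0) {a : ℝ≥0∞} (ha : a ≠ ⊤) :
    ∀ᵐ s ∂expMeasure 1, waitTime (ENNReal.ofReal s) r ≠ a := by
  by_cases hr : r = 0
  · exact ae_of_all _ fun s => by simp [waitTime, hr, ha.symm]
  have h0 : ∀ᵐ s ∂expMeasure 1, s ≠ (a * r).toReal := by
    rw [ae_iff]
    simpa using noAtoms_expMeasure 1 (a * r).toReal
  filter_upwards [h0, ae_pos_expMeasure one_pos] with s hs hs0 h
  rw [waitTime, if_neg hr] at h
  apply hs
  rw [← h, ENNReal.div_mul_cancel (by simpa using hr) (by simp), ENNReal.toReal_ofReal hs0.le]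

/-- The rules `ρ` are those of the system `D` as long as the process stays above level zero, and a
catastrophe that leads to a nonpositive level in the system does so under `ρ`. -/
structure AgreesAbove (D : Params) (ρ : Rules) : Prop where
  speed_eq : ∀ j, 0 < j → ρ.speed j = D.speed j
  catTarget_eq : ∀ i, 0 < i → ρ.catTarget i = i
  catTarget_nonpos : ∀ i, i ≤ 0 → ρ.catTarget i ≤ 0

lemma agreesAbove_free (D : Params) : AgreesAbove D D.free :=
  ⟨fun _ _ => rfl, fun _ _ => rfl, fun _ h => h⟩

lemma agreesAbove_reflected (D : Params) : AgreesAbove D (D.reflected 0) where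
  speed_eq j hj := by simp [Params.reflected, hj.ne']
  catTarget_eq i hi := by simp [Params.reflected, hi.le]
  catTarget_nonpos i hi := by simp [Params.reflected, hi]

/-- Two states at the same positive level with the same residual works above level zero. -/
def SameAbove (x y : State) : Prop :=
  0 < x.level ∧ y.level = x.level ∧ ∀ i, 0 < i → y.residual i = x.residual i

section Coupling

variable {D : Params} {ρ ρ' : Rules} {x y : State} {q : ℝ}

lemma holding_congr (hρ : AgreesAbove D ρ) (hρ' : AgreesAbove D ρ') (h : SameAbove x y)
    (ξ : Innovation) : D.holding ρ' y ξ = D.holding ρ x ξ := by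
  unfold Params.holding
  rw [h.2.1, hρ.speed_eq _ h.1, hρ'.speed_eq _ h.1, h.2.2 _ h.1]

lemma workBefore_congr (hρ : AgreesAbove D ρ) (hρ' : AgreesAbove D ρ') (h : SameAbove x y)
    (ξ : Innovation) {i : ℤ} (hi : 0 < i) : D.workBefore ρ' y ξ i = D.workBefore ρ x ξ i := by
  unfold Params.workBefore
  rw [holding_congr hρ hρ' h, h.2.1, hρ.speed_eq _ h.1, hρ'.speed_eq _ h.1, h.2.2 _ h.1]
  simp only [Function.update_apply, h.2.2 _ hi]

/-- A step from a positive level reads only data above level zero. The two states therefore move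
alike, or both become nonpositive at the same event; no claim is made about where they land then,
nor about residual works at nonpositive levels. -/
lemma next_congr (hρ : AgreesAbove D ρ) (hρ' : AgreesAbove D ρ') (h : SameAbove x y)
    (ξ : Innovation) : SameAbove (D.next ρ x ξ) (D.next ρ' y ξ) ∨
      ((D.next ρ x ξ).level ≤ 0 ∧ (D.next ρ' y ξ).level ≤ 0) := by
  have hw := fun i hi => workBefore_congr hρ hρ' h ξ (i := i) hi
  have hb : 0 ≤ ξ.batch x.level := Int.natCast_nonneg _
  have h0 := h.1
  unfold Params.next SameAbove
  rw [holding_congr hρ hρ' h, h.2.1]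
  dsimp only
  split_ifs
  · left
    refine ⟨by simp only; omega, rfl, fun i hi => ?_⟩
    simp only [hw i hi]
  · left
    refine ⟨by simp only; omega, rfl, fun i hi => ?_⟩
    simp only [hw i hi]
  · rcases le_or_gt (x.level - ξ.removed x.level) 0 with h1 | h1
    · exact Or.inr ⟨hρ.catTarget_nonpos _ h1, hρ'.catTarget_nonpos _ h1⟩
    · left
      simp only [hρ.catTarget_eq _ h1, hρ'.catTarget_eq _ h1]
      exact ⟨h1, trivial, hw⟩
  · rcases le_or_gt (x.level - 1) 0 with h1 | h1
    · exact Or.inr ⟨h1, h1⟩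
    · exact Or.inl ⟨h1, rfl, hw⟩

/-- The probability to be at level `k` after exactly `n` events, with all levels up to then
positive, and that a clock of rate `q` rings before the next event. -/
def excursionTerm (D : Params) (ρ : Rules) (q : ℝ) (k : ℤ) (n : ℕ) : State → ℝ≥0∞ :=
  (killedStep D ρ q (Ioi 0))^[n] (indicator (State.level ⁻¹' {k}) (ringProb D ρ q))

/-- The probability that a clock of rate `q` rings at level `k`, before the levels stop being
positive. -/
def excursion (D : Params) (ρ : Rules) (q : ℝ) (k : ℤ) (x : State) : ℝ≥0∞ :=
  ∑' n, excursionTerm D ρ q k n x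

lemma measurable_excursionTerm (k : ℤ) (n : ℕ) : Measurable (excursionTerm D ρ q k n) :=
  measurable_iterate_killedStep _ (measurable_ringProb.indicator (measurable_preimage_level _)) n

lemma measurable_excursion (k : ℤ) : Measurable (excursion D ρ q k) :=
  Measurable.tsum fun n => measurable_excursionTerm k n

lemma excursionTerm_of_nonpos {k : ℤ} (hk : 0 < k) (n : ℕ) (hx : x.level ≤ 0) :
    excursionTerm D ρ q k n x = 0 := by
  cases n with
  | zero =>
    have h : x ∉ State.level ⁻¹' {k} := fun h => by
      have : x.level = k := h
      omega
    exact indicator_of_notMem h _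
  | succ n =>
    rw [excursionTerm, Function.iterate_succ_apply', killedStep]
    have h : x ∉ State.level ⁻¹' Ioi 0 := fun h => not_lt.2 hx h
    exact indicator_of_notMem h _

lemma excursion_of_nonpos {k : ℤ} (hk : 0 < k) (hx : x.level ≤ 0) :
    excursion D ρ q k x = 0 := by
  simp [excursion, excursionTerm_of_nonpos hk _ hx]

/-- Killing at nonpositive levels stops the chain before the data in which the two states or rules
may differ could be read. As `k` is positive, paths that have dropped that far contribute nothing on
either side. -/
lemma excursionTerm_congr (hρ : AgreesAbove D ρ) (hρ' : AgreesAbove D ρ') {k : ℤ} (hk : 0 < k)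
    (n : ℕ) (h : SameAbove x y) : excursionTerm D ρ' q k n y = excursionTerm D ρ q k n x := by
  induction n generalizing x y with
  | zero =>
    simp only [excursionTerm, Function.iterate_zero_apply, indicator, mem_preimage, h.2.1,
      ringProb, holding_congr hρ hρ' h]
  | succ n ih =>
    simp only [excursionTerm, Function.iterate_succ_apply'] at ih ⊢
    have h1 : x ∈ State.level ⁻¹' Ioi 0 := h.1
    have h2 : y ∈ State.level ⁻¹' Ioi 0 := by rw [mem_preimage, h.2.1]; exact h.1
    rw [killedStep, killedStep, indicator_of_mem h1, indicator_of_mem h2, step, step]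
    congr 1 with ξ
    rw [holding_congr hρ hρ' h]
    congr 1
    rcases next_congr hρ hρ' h ξ with h3 | ⟨h3, h4⟩
    · exact ih h3
    · exact (excursionTerm_of_nonpos hk n h4).trans (excursionTerm_of_nonpos hk n h3).symm

lemma excursion_congr (hρ : AgreesAbove D ρ) (hρ' : AgreesAbove D ρ') {k : ℤ} (hk : 0 < k)
    (h : SameAbove x y) : excursion D ρ' q k y = excursion D ρ q k x :=
  tsum_congr fun n => excursionTerm_congr hρ hρ' hk n h

end Coupling

/-! ### Departures from level zero. -/

section LevelZero

variable (D : Params) {ρ : Rules} {q : ℝ}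

/-- The sizes and works of an innovation. -/
abbrev Marks : Type := (ℤ → ℕ) × (ℤ → ℕ) × (ℤ → ℝ≥0)

/-- The law of the sizes and works of an innovation. -/
def marksLaw : Measure Marks :=
  (Measure.infinitePi fun j => (D.batchSize j).toMeasure).prod <|
    (Measure.infinitePi fun j => (D.catSize j).toMeasure).prod <|
      Measure.infinitePi fun j => (D.workLaw j : Measure ℝ≥0)

instance : IsProbabilityMeasure (marksLaw D) := by
  unfold marksLaw
  infer_instance

/-- Clocks and marks are independent: which event comes first, and when, carries no information on
the sizes and works that it brings. -/
lemma lintegral_innovationLaw {f : ℝ × ℝ × ℝ → ℝ≥0∞} (hf : Measurable f) {g : Marks → ℝ≥0∞}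
    (hg : Measurable g) :
    ∫⁻ ξ, f (ξ.1, ξ.2.1, ξ.2.2.1) * g ξ.2.2.2 ∂D.innovationLaw =
      (∫⁻ s, ∫⁻ b, ∫⁻ c, f (s, b, c) ∂expMeasure 1 ∂expMeasure 1 ∂expMeasure 1) *
        ∫⁻ m, g m ∂marksLaw D := by
  have h : D.innovationLaw =
    (expMeasure 1).prod ((expMeasure 1).prod ((expMeasure 1).prod (marksLaw D))) := rfl
  rw [h, lintegral_prod _ (by fun_prop), ← lintegral_mul_const _ (by fun_prop)]
  congr 1 with s
  rw [lintegral_prod _ (by fun_prop), ← lintegral_mul_const _ (by fun_prop)]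
  congr 1 with b
  rw [lintegral_prod _ (by fun_prop), ← lintegral_mul_const _ (by fun_prop)]
  congr 1 with c
  dsimp only
  rw [lintegral_const_mul _ hg]

/-- The holding time at level zero in terms of the clock readings, for time `τ` to completion. -/
def holdingZero (τ : ℝ≥0∞) (p : ℝ × ℝ × ℝ) : ℝ≥0∞ :=
  min (min (waitTime (ENNReal.ofReal p.1) (D.singleRate 0))
      (waitTime (ENNReal.ofReal p.2.1) (D.batchRate 0)))
    (min (waitTime (ENNReal.ofReal p.2.2) (D.catRate 0)) τ)

/-- The probability, given the clock readings, to ring at level zero before the next event. -/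
def ringZero (q : ℝ) (τ : ℝ≥0∞) (p : ℝ × ℝ × ℝ) : ℝ≥0∞ := 1 - disc q (holdingZero D τ p)

open Classical in
/-- The discount factor of the next event at level zero if it is a single arrival. -/
def singleDisc (q : ℝ) (τ : ℝ≥0∞) (p : ℝ × ℝ × ℝ) : ℝ≥0∞ :=
  if waitTime (ENNReal.ofReal p.1) (D.singleRate 0) = holdingZero D τ p then
    disc q (holdingZero D τ p) else 0

open Classical in
/-- The discount factor of the next event at level zero if it is a batch arrival. -/
def batchDisc (q : ℝ) (τ : ℝ≥0∞) (p : ℝ × ℝ × ℝ) : ℝ≥0∞ :=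
  if waitTime (ENNReal.ofReal p.1) (D.singleRate 0) = holdingZero D τ p then 0
  else if waitTime (ENNReal.ofReal p.2.1) (D.batchRate 0) = holdingZero D τ p then
    disc q (holdingZero D τ p) else 0

lemma measurable_waitTime_ofReal (r : ℝ≥0) : Measurable fun s => waitTime (ENNReal.ofReal s) r :=
  (measurable_waitTime r).comp ENNReal.measurable_ofReal

lemma measurable_holdingZero (τ : ℝ≥0∞) : Measurable (holdingZero D τ) :=
  (((measurable_waitTime_ofReal _).comp measurable_fst).min
    ((measurable_waitTime_ofReal _).comp (measurable_fst.comp measurable_snd))).min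
    (((measurable_waitTime_ofReal _).comp (measurable_snd.comp measurable_snd)).min
      measurable_const)

lemma measurable_ringZero (q : ℝ) (τ : ℝ≥0∞) : Measurable (ringZero D q τ) :=
  measurable_const.sub ((measurable_disc q).comp (measurable_holdingZero D τ))

lemma measurable_singleDisc (q : ℝ) (τ : ℝ≥0∞) : Measurable (singleDisc D q τ) := by
  classical
  exact Measurable.ite (measurableSet_eq_fun ((measurable_waitTime_ofReal _).comp measurable_fst)
    (measurable_holdingZero D τ)) ((measurable_disc q).comp (measurable_holdingZero D τ))
    measurable_const

lemma measurable_batchDisc (q : ℝ) (τ : ℝ≥0∞) : Measurable (batchDisc D q τ) := by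
  classical
  exact Measurable.ite (measurableSet_eq_fun ((measurable_waitTime_ofReal _).comp measurable_fst)
    (measurable_holdingZero D τ)) measurable_const (Measurable.ite (measurableSet_eq_fun
      ((measurable_waitTime_ofReal _).comp (measurable_fst.comp measurable_snd))
    (measurable_holdingZero D τ)) ((measurable_disc q).comp (measurable_holdingZero D τ))
    measurable_const)

/-- With the other two clocks fixed, all competing events merge into one deadline `y`, and
`exp_clock_balance` applies to the remaining clock. The factor of proportionality does not involve
`τ`, the only place where the past and the rules enter. -/
lemma lintegral_singleDisc (hq : 0 < q) (τ : ℝ≥0∞) :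
    ENNReal.ofReal q * ∫⁻ s, ∫⁻ b, ∫⁻ c, singleDisc D q τ (s, b, c)
        ∂expMeasure 1 ∂expMeasure 1 ∂expMeasure 1 =
      D.singleRate 0 * ∫⁻ s, ∫⁻ b, ∫⁻ c, ringZero D q τ (s, b, c)
        ∂expMeasure 1 ∂expMeasure 1 ∂expMeasure 1 := by
  have hm1 := measurable_singleDisc D q τ
  have hm2 := measurable_ringZero D q τ
  have key : ∀ f : ℝ × ℝ × ℝ → ℝ≥0∞, Measurable f →
      ∫⁻ s, ∫⁻ b, ∫⁻ c, f (s, b, c) ∂expMeasure 1 ∂expMeasure 1 ∂expMeasure 1 =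
        ∫⁻ p, ∫⁻ s, f (s, p) ∂expMeasure 1 ∂(expMeasure 1).prod (expMeasure 1) := by
    intro f hf
    have h : ∀ s, ∫⁻ b, ∫⁻ c, f (s, b, c) ∂expMeasure 1 ∂expMeasure 1 =
        ∫⁻ p, f (s, p) ∂(expMeasure 1).prod (expMeasure 1) := fun s =>
      (lintegral_prod (fun p => f (s, p)) (by fun_prop)).symm
    simp_rw [h]
    exact lintegral_lintegral_swap (f := fun s p => f (s, p)) (by fun_prop)
  rw [key _ hm1, key _ hm2, ← lintegral_const_mul _ (by fun_prop),
    ← lintegral_const_mul _ (by fun_prop)]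
  congr 1 with p
  set y := min (waitTime (ENNReal.ofReal p.1) (D.batchRate 0))
    (min (waitTime (ENNReal.ofReal p.2) (D.catRate 0)) τ) with hy
  have hh : ∀ s, holdingZero D τ (s, p) =
      min (waitTime (ENNReal.ofReal s) (D.singleRate 0)) y := fun s => by
    rw [holdingZero, hy, min_assoc]
  simp_rw [ringZero, hh]
  rw [← exp_clock_balance hq, ← lintegral_indicator
    (measurableSet_le (measurable_waitTime_ofReal _) measurable_const)]
  congr 2 with s
  rw [singleDisc, hh]
  by_cases h : waitTime (ENNReal.ofReal s) (D.singleRate 0) ≤ y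
  · rw [min_eq_left h, if_pos rfl, indicator_of_mem (by exact h)]
  · rw [min_eq_right (le_of_not_ge h), if_neg (fun h' => h h'.le), indicator_of_notMem (by exact h)]

/-- As for single arrivals, now integrating the batch clock first. The rule that a single arrival
wins a tie has no effect: finite ties have probability zero, and infinite ones have discount zero.
-/
lemma lintegral_batchDisc (hq : 0 < q) (τ : ℝ≥0∞) :
    ENNReal.ofReal q * ∫⁻ s, ∫⁻ b, ∫⁻ c, batchDisc D q τ (s, b, c)
        ∂expMeasure 1 ∂expMeasure 1 ∂expMeasure 1 =
      D.batchRate 0 * ∫⁻ s, ∫⁻ b, ∫⁻ c, ringZero D q τ (s, b, c)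
        ∂expMeasure 1 ∂expMeasure 1 ∂expMeasure 1 := by
  have hm1 := measurable_batchDisc D q τ
  have hm2 := measurable_ringZero D q τ
  have key : ∀ f : ℝ × ℝ × ℝ → ℝ≥0∞, Measurable f → ∀ s,
      ∫⁻ b, ∫⁻ c, f (s, b, c) ∂expMeasure 1 ∂expMeasure 1 =
        ∫⁻ c, ∫⁻ b, f (s, b, c) ∂expMeasure 1 ∂expMeasure 1 := by
    intro f hf s
    exact lintegral_lintegral_swap (by fun_prop)
  simp_rw [key _ hm1, key _ hm2]
  rw [← lintegral_const_mul _ (by fun_prop), ← lintegral_const_mul _ (by fun_prop)]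
  congr 1 with s
  rw [← lintegral_const_mul _ (by fun_prop), ← lintegral_const_mul _ (by fun_prop)]
  congr 1 with c
  set S := waitTime (ENNReal.ofReal s) (D.singleRate 0) with hS
  set y := min S (min (waitTime (ENNReal.ofReal c) (D.catRate 0)) τ) with hy
  have hh : ∀ b, holdingZero D τ (s, b, c) =
      min (waitTime (ENNReal.ofReal b) (D.batchRate 0)) y := fun b => by
    rw [holdingZero, hy, min_assoc, min_left_comm]
  simp_rw [ringZero, hh]
  rw [← exp_clock_balance hq, ← lintegral_indicator
    (measurableSet_le (measurable_waitTime_ofReal _) measurable_const)]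
  congr 1
  apply lintegral_congr_ae
  have hne : ∀ᵐ b ∂expMeasure 1, waitTime (ENNReal.ofReal b) (D.batchRate 0) = S → S = ⊤ := by
    by_cases hS : S = ⊤
    · exact ae_of_all _ fun _ _ => hS
    · filter_upwards [ae_waitTime_ne (D.batchRate 0) hS] with b hb h
      exact absurd h hb
  filter_upwards [hne] with b hb
  rw [batchDisc, hh, ← hS]
  dsimp only
  by_cases h : waitTime (ENNReal.ofReal b) (D.batchRate 0) ≤ y
  · rw [min_eq_left h, if_pos rfl, indicator_of_mem (by exact h)]
    split_ifs with h1
    · rw [← h1, hb h1.symm, disc_top]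
    · rfl
  · rw [min_eq_right (le_of_not_ge h), indicator_of_notMem (by exact h)]
    rw [if_neg (fun h' : _ = y => h h'.le)]
    simp

/-- The ratio of the probabilities that a clock of rate `q` rings at level `k` during an excursion
above level zero, and that it rings at level zero. -/
def excursionRatio (q : ℝ) (k : ℤ) : ℝ≥0∞ :=
  (ENNReal.ofReal q)⁻¹ *
    (D.singleRate 0 * ∫⁻ m, excursion D D.free q k (initState 1 m.2.2) ∂marksLaw D +
      D.batchRate 0 * ∫⁻ m, excursion D D.free q k (initState (m.1 0 : ℤ) m.2.2) ∂marksLaw D)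

lemma ringProb_of_level_zero {x : State} (hx : x.level = 0) :
    ringProb D ρ q x = ∫⁻ s, ∫⁻ b, ∫⁻ c,
      ringZero D q (waitTime (x.residual 0) (ρ.speed 0)) (s, b, c)
        ∂expMeasure 1 ∂expMeasure 1 ∂expMeasure 1 := by
  set τ := waitTime (x.residual 0) (ρ.speed 0) with hτ
  have hm2 := measurable_ringZero D q τ
  have h := lintegral_innovationLaw D hm2 (g := fun _ => 1) measurable_const
  simp only [mul_one, lintegral_const, measure_univ] at h
  rw [← h, ringProb]
  unfold Params.holding
  rw [hx]
  rfl

/-- A step from level zero into an excursion. -/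
lemma step_excursion {k : ℤ} (hk : 0 < k) (hq : 0 < q) (hρ : AgreesAbove D ρ) {x : State}
    (hx : x.level = 0) :
    step D ρ q (excursion D ρ q k) x = excursionRatio D q k * ringProb D ρ q x := by
  set τ := waitTime (x.residual 0) (ρ.speed 0) with hτ
  set g₁ : Marks → ℝ≥0∞ := fun m => excursion D D.free q k (initState 1 m.2.2) with hg₁
  set g₂ : Marks → ℝ≥0∞ := fun m => excursion D D.free q k (initState (m.1 0 : ℤ) m.2.2) with hg₂
  have hg₁m : Measurable g₁ := (measurable_excursion k).comp
    ((measurable_initState 1).comp (by fun_prop))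
  have hg₂m : Measurable g₂ := by
    have h0 : Measurable fun m : Marks => m.1 0 := by fun_prop
    have h1 : Measurable fun m : Marks => initState (m.1 0 : ℤ) m.2.2 :=
      measurable_state_iff.2 ⟨measurable_const,
        (measurable_of_countable (fun n : ℕ => (n : ℤ))).comp h0,
        (measurable_residual.comp (measurable_initState 0)).comp
          (measurable_snd.comp measurable_snd)⟩
    exact (measurable_excursion k).comp h1
  -- From level zero only arrivals reach positive levels; after a catastrophe or a completion the
  -- excursion term vanishes. An arrival makes every entry above zero fresh, so the excursion under
  -- `ρ` may be replaced by the one under the free rules.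
  have hint : ∀ ξ : Innovation, disc q (D.holding ρ x ξ) * excursion D ρ q k (D.next ρ x ξ) =
      singleDisc D q τ (ξ.1, ξ.2.1, ξ.2.2.1) * g₁ ξ.2.2.2 +
        batchDisc D q τ (ξ.1, ξ.2.1, ξ.2.2.1) * g₂ ξ.2.2.2 := by
    intro ξ
    have hh : D.holding ρ x ξ = holdingZero D τ (ξ.1, ξ.2.1, ξ.2.2.1) := by
      unfold Params.holding
      rw [hx]
      rfl
    have hS : waitTime ξ.singleClock (D.singleRate x.level) =
      waitTime (ENNReal.ofReal ξ.1) (D.singleRate 0) := by rw [hx]; rfl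
    have hB : waitTime ξ.batchClock (D.batchRate x.level) =
      waitTime (ENNReal.ofReal ξ.2.1) (D.batchRate 0) := by rw [hx]; rfl
    unfold Params.next singleDisc batchDisc
    dsimp only
    rw [hh, hS, hB]
    split_ifs with h1 h2 h3
    · rw [zero_mul, add_zero]
      congr 1
      refine excursion_congr (agreesAbove_free D) hρ hk ⟨one_pos, by simp [hx, initState], ?_⟩
      intro i hi
      simp [hx, hi, initState, Innovation.work]
    · rw [zero_mul, zero_add]
      congr 1
      -- The identity is claimed for every `ξ`, so an empty batch has to be admitted here; both
      -- excursion terms are then zero.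
      rcases (Int.natCast_nonneg (ξ.2.2.2.1 0)).eq_or_lt with h0 | h0
      · simp only [hg₂]
        rw [excursion_of_nonpos hk, excursion_of_nonpos hk]
        · exact h0.ge
        · simp only [hx, Innovation.batch]
          omega
      · refine excursion_congr (agreesAbove_free D) hρ hk ⟨h0, ?_, ?_⟩
        · simp [hx, initState, Innovation.batch]
        · intro i hi
          simp [hx, hi, initState, Innovation.work]
    · rw [excursion_of_nonpos hk]
      · simp
      · have : 0 ≤ ξ.removed x.level := Int.natCast_nonneg _
        exact hρ.catTarget_nonpos _ (by omega)
    · rw [excursion_of_nonpos hk]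
      · simp
      · simp only; omega
  have hq0 : ENNReal.ofReal q ≠ 0 := by simpa using hq
  rw [step]
  simp_rw [hint]
  have hpm : Measurable fun ξ : Innovation => (ξ.1, ξ.2.1, ξ.2.2.1) := by fun_prop
  have hm1 : Measurable fun ξ : Innovation =>
      singleDisc D q τ (ξ.1, ξ.2.1, ξ.2.2.1) * g₁ ξ.2.2.2 :=
    ((measurable_singleDisc D q τ).comp hpm).mul
      (hg₁m.comp (measurable_snd.comp (measurable_snd.comp measurable_snd)))
  rw [lintegral_add_left hm1,
    lintegral_innovationLaw D (measurable_singleDisc D q τ) hg₁m,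
    lintegral_innovationLaw D (measurable_batchDisc D q τ) hg₂m]
  rw [excursionRatio, ringProb_of_level_zero D hx]
  have h1 := lintegral_singleDisc D hq τ
  have h2 := lintegral_batchDisc D hq τ
  rw [← hτ]
  rw [mul_assoc, add_mul, mul_right_comm, ← h1, mul_right_comm (D.batchRate 0 : ℝ≥0∞), ← h2]
  rw [mul_assoc, mul_assoc, ← mul_add, ← mul_assoc, ENNReal.inv_mul_cancel hq0 (by simp), one_mul]

/-- The visits to level `k > 0` decomposed at the last visit to level zero. -/
lemma tsum_visits_eq {k : ℤ} (hk : 0 < k) (hq : 0 < q) (hρ : AgreesAbove D ρ) (x : State) :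
    ∑' n, (killedStep D ρ q (Ici 0))^[n]
        (indicator (State.level ⁻¹' {k}) (ringProb D ρ q)) x =
      ∑' n, (killedStep D ρ q (Ioi 0))^[n]
        (indicator (State.level ⁻¹' {k}) (ringProb D ρ q)) x +
      excursionRatio D q k * ∑' n, (killedStep D ρ q (Ici 0))^[n]
        (indicator (State.level ⁻¹' {0}) (ringProb D ρ q)) x := by
  have hU : (Ici 0 : Set ℤ) = Ioi 0 ∪ {0} := Ioi_union_left.symm
  have hm : ∀ j : ℤ, Measurable (indicator (State.level ⁻¹' {j}) (ringProb D ρ q)) := fun j =>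
    measurable_ringProb.indicator (measurable_preimage_level _)
  -- In the resolvent identity with `A = Ioi 0` and `B = {0}`, the term `K_B G_A` reduces to a
  -- constant times ringing at level zero, and the constant can be pulled out of the series.
  have h1 : killedStep D ρ q {0} (fun y => ∑' j, (killedStep D ρ q (Ioi 0))^[j]
      (indicator (State.level ⁻¹' {k}) (ringProb D ρ q)) y) =
      fun y => excursionRatio D q k * indicator (State.level ⁻¹' {0}) (ringProb D ρ q) y := by
    ext y
    by_cases hy : y ∈ State.level ⁻¹' {0}
    · rw [killedStep, indicator_of_mem hy, indicator_of_mem hy]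
      exact step_excursion D hk hq hρ hy
    · rw [killedStep, indicator_of_notMem hy, indicator_of_notMem hy, mul_zero]
  rw [hU, tsum_iterate_killedStep_last_exit (by simp) (hm k), h1]
  simp_rw [iterate_killedStep_const_mul _ _ (hm 0)]
  rw [ENNReal.tsum_mul_left]

end LevelZero

/-! ### Events do not accumulate at zero distance -/

lemma ae_seqCons {α : Type*} [MeasurableSpace α] (ν : Measure α) [IsProbabilityMeasure ν]
    {p : (ℕ → α) → Prop} (hp : MeasurableSet {ξ | p ξ})
    (h : ∀ᵐ a ∂ν, ∀ᵐ ξ ∂(Measure.infinitePi fun _ : ℕ => ν), p (seqCons (a, ξ))) :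
    ∀ᵐ ξ ∂(Measure.infinitePi fun _ : ℕ => ν), p ξ := by
  rw [← map_seqCons ν]
  refine (ae_map_iff measurable_seqCons.aemeasurable hp).2 ?_
  exact (Measure.ae_prod_iff_ae_ae (measurable_seqCons hp)).2 h

/-- A set of levels that the system with rules `ρ` does not leave, and in which catastrophes do not
lead upwards. -/
structure IsInvariant (D : Params) (ρ : Rules) (S : Set ℤ) : Prop where
  add_mem : ∀ j ∈ S, ∀ n : ℤ, 0 ≤ n → j + n ∈ S
  catTarget_mem : ∀ i, ρ.catTarget i ∈ S
  catTarget_le : ∀ j ∈ S, ∀ i ≤ j, ρ.catTarget i ≤ j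
  sub_one_mem : ∀ j ∈ S, ρ.speed j ≠ 0 → j - 1 ∈ S

lemma isInvariant_free (D : Params) : IsInvariant D D.free univ :=
  ⟨fun _ _ _ _ => trivial, fun _ => trivial, fun _ _ _ h => h, fun _ _ _ => trivial⟩

lemma isInvariant_reflected (D : Params) : IsInvariant D (D.reflected 0) (Ici 0) where
  add_mem j hj n hn := by simp only [mem_Ici] at hj ⊢; omega
  catTarget_mem i := le_max_left 0 i
  catTarget_le j hj i hi := max_le hj hi
  sub_one_mem j hj h := by
    have : j ≠ 0 := by rintro rfl; simp [Params.reflected] at h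
    simp only [mem_Ici] at hj ⊢
    omega

section Positivity

variable {D : Params} {ρ : Rules} {S : Set ℤ}

lemma holding_le_completion (x : State) (ξ : Innovation) :
    D.holding ρ x ξ ≤ waitTime (x.residual x.level) (ρ.speed x.level) :=
  (min_le_right _ _).trans (min_le_right _ _)

lemma next_level_mem (hS : IsInvariant D ρ S) {x : State} (hx : x.level ∈ S) (ξ : Innovation) :
    (D.next ρ x ξ).level ∈ S := by
  unfold Params.next
  dsimp only
  split_ifs with h1 h2 h3
  · exact hS.add_mem _ hx 1 zero_le_one
  · exact hS.add_mem _ hx _ (Int.natCast_nonneg _)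
  · exact hS.catTarget_mem _
  -- No completion occurs at speed zero: the holding time is then the minimum of the three clock
  -- times, so an earlier branch is taken, even if all of them are infinite.
  · refine hS.sub_one_mem _ hx fun h0 => ?_
    have h4 : D.holding ρ x ξ =
      min (min (waitTime ξ.singleClock (D.singleRate x.level))
        (waitTime ξ.batchClock (D.batchRate x.level)))
        (waitTime ξ.catClock (D.catRate x.level)) := by
      have h5 : waitTime (x.residual x.level) (ρ.speed x.level) = ⊤ := by simp [waitTime, h0]
      unfold Params.holding
      rw [h5, min_top_right]
    rcases min_choice (min (waitTime ξ.singleClock (D.singleRate x.level))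
        (waitTime ξ.batchClock (D.batchRate x.level)))
        (waitTime ξ.catClock (D.catRate x.level)) with h5 | h5
    · rcases min_choice (waitTime ξ.singleClock (D.singleRate x.level))
        (waitTime ξ.batchClock (D.batchRate x.level)) with h6 | h6
      · exact h1 (by rw [h4, h5, h6])
      · exact h2 (by rw [h4, h5, h6])
    · exact h3 (by rw [h4, h5])

lemma chain_level_mem (hS : IsInvariant D ρ S) {x : State} (hx : x.level ∈ S)
    (ξ : ℕ → Innovation) (n : ℕ) : (chain D ρ x ξ n).level ∈ S := by
  induction n with
  | zero => exact hx
  | succ n ih => exact next_level_mem hS ih _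

/-- All customers who are present have a positive finite residual amount of work. -/
def ResidualPos (x : State) : Prop :=
  ∀ i ≤ x.level, 0 < x.residual i ∧ x.residual i ≠ ⊤

lemma waitTime_pos {w : ℝ≥0∞} (hw : 0 < w) (r : ℝ≥0) : 0 < waitTime w r := by
  unfold waitTime
  split_ifs
  · simp
  · exact ENNReal.div_pos hw.ne' (by simp)

lemma ae_singleClock {p : ℝ → Prop} (h : ∀ᵐ s ∂expMeasure 1, p s) :
    ∀ᵐ ξ ∂D.innovationLaw, p ξ.1 :=
  Measure.quasiMeasurePreserving_fst.ae h

lemma ae_batchClock {p : ℝ → Prop} (h : ∀ᵐ s ∂expMeasure 1, p s) :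
    ∀ᵐ ξ ∂D.innovationLaw, p ξ.2.1 :=
  (Measure.quasiMeasurePreserving_fst.comp Measure.quasiMeasurePreserving_snd).ae h

lemma ae_catClock {p : ℝ → Prop} (h : ∀ᵐ s ∂expMeasure 1, p s) :
    ∀ᵐ ξ ∂D.innovationLaw, p ξ.2.2.1 :=
  (Measure.quasiMeasurePreserving_fst.comp
    (Measure.quasiMeasurePreserving_snd.comp Measure.quasiMeasurePreserving_snd)).ae h

lemma ae_works_pos (D : Params) :
    ∀ᵐ w ∂(Measure.infinitePi fun j => (D.workLaw j : Measure ℝ≥0)), ∀ i, 0 < w i := by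
  rw [ae_all_iff]
  intro i
  have h : ∀ᵐ v ∂(D.workLaw i : Measure ℝ≥0), 0 < v := by
    rw [ae_iff]
    simpa using D.workLaw_zero i
  exact (measurePreserving_eval_infinitePi
    (fun j => (D.workLaw j : Measure ℝ≥0)) i).quasiMeasurePreserving.ae h

lemma ae_work_pos : ∀ᵐ ξ ∂D.innovationLaw, ∀ i, 0 < ξ.work i := by
  have h : ∀ᵐ ξ ∂D.innovationLaw, ∀ i, 0 < ξ.2.2.2.2.2 i :=
    (Measure.quasiMeasurePreserving_snd.comp (Measure.quasiMeasurePreserving_snd.comp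
      (Measure.quasiMeasurePreserving_snd.comp (Measure.quasiMeasurePreserving_snd.comp
        Measure.quasiMeasurePreserving_snd)))).ae (ae_works_pos D)
  filter_upwards [h] with ξ hξ i
  exact ENNReal.coe_pos.2 (hξ i)

lemma ae_holding_pos {x : State} (hx : ResidualPos x) :
    ∀ᵐ ξ ∂D.innovationLaw, 0 < D.holding ρ x ξ := by
  filter_upwards [ae_singleClock (ae_pos_expMeasure one_pos),
    ae_batchClock (ae_pos_expMeasure one_pos), ae_catClock (ae_pos_expMeasure one_pos)]
    with ξ h1 h2 h3
  exact lt_min (lt_min (waitTime_pos (ENNReal.ofReal_pos.2 h1) _)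
    (waitTime_pos (ENNReal.ofReal_pos.2 h2) _)) (lt_min (waitTime_pos (ENNReal.ofReal_pos.2 h3) _)
      (waitTime_pos (hx _ le_rfl).1 _))

/-- Given `x`, the completion time `a` is deterministic, and almost surely no clock rings exactly at
a finite `a`. A customer who is interrupted thus keeps positive work; a completion lowers the level
below the exhausted entry. -/
lemma ae_residualPos_next (hS : IsInvariant D ρ S) {x : State} (hxS : x.level ∈ S)
    (hx : ResidualPos x) : ∀ᵐ ξ ∂D.innovationLaw, ResidualPos (D.next ρ x ξ) := by
  set a := waitTime (x.residual x.level) (ρ.speed x.level) with ha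
  have hne : ∀ r : ℝ≥0, ∀ᵐ s ∂expMeasure 1, waitTime (ENNReal.ofReal s) r = a → a = ⊤ := by
    intro r
    by_cases h : a = ⊤
    · exact ae_of_all _ fun _ _ => h
    · filter_upwards [ae_waitTime_ne r h] with s hs h'
      exact absurd h' hs
  filter_upwards [ae_work_pos, ae_singleClock (hne (D.singleRate x.level)),
    ae_batchClock (hne (D.batchRate x.level)), ae_catClock (hne (D.catRate x.level))]
    with ξ hw h1 h2 h3
  have hle : D.holding ρ x ξ ≤ a := holding_le_completion x ξ
  have hother : ∀ i ≤ x.level, i ≠ x.level →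
      0 < D.workBefore ρ x ξ i ∧ D.workBefore ρ x ξ i ≠ ⊤ := by
    intro i hi hne
    simp only [Params.workBefore, Function.update_apply, hne, if_false]
    exact hx i hi
  have hall : (D.holding ρ x ξ = a → a = ⊤) → ∀ i ≤ x.level,
      0 < D.workBefore ρ x ξ i ∧ D.workBefore ρ x ξ i ≠ ⊤ := by
    intro hlt i hi
    by_cases hil : i = x.level
    · subst hil
      obtain ⟨hr0, hrt⟩ := hx _ le_rfl
      simp only [Params.workBefore, Function.update_self]
      refine ⟨?_, ne_top_of_le_ne_top hrt tsub_le_self⟩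
      by_cases hs : ρ.speed x.level = 0
      · simpa [hs] using hr0
      · have hs' : (ρ.speed x.level : ℝ≥0∞) ≠ 0 := by simpa using hs
        have hat : a ≠ ⊤ := by
          rw [ha, waitTime, if_neg hs]
          exact ENNReal.div_ne_top hrt hs'
        have hlt' : D.holding ρ x ξ < a := lt_of_le_of_ne hle fun h => hat (hlt h)
        rw [ha, waitTime, if_neg hs, ENNReal.lt_div_iff_mul_lt (Or.inl hs') (Or.inl (by simp)),
          mul_comm] at hlt'
        exact tsub_pos_of_lt hlt'
    · exact hother i hi hil
  have hnew : (D.holding ρ x ξ = a → a = ⊤) → ∀ i,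
      0 < (if x.level < i then ξ.work i else D.workBefore ρ x ξ i) ∧
        (if x.level < i then ξ.work i else D.workBefore ρ x ξ i) ≠ ⊤ := by
    intro h i
    split_ifs with hi
    · exact ⟨hw i, ENNReal.coe_ne_top⟩
    · exact hall h i (not_lt.1 hi)
  unfold Params.next
  dsimp only
  split_ifs with g1 g2 g3
  · exact fun i _ => hnew (fun h => h1 (g1.trans h)) i
  · exact fun i _ => hnew (fun h => h2 (g2.trans h)) i
  · intro i hi
    refine hall (fun h => h3 (g3.trans h)) i (hi.trans (hS.catTarget_le _ hxS _ ?_))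
    have : 0 ≤ ξ.removed x.level := Int.natCast_nonneg _
    omega
  · intro i hi
    dsimp only at hi
    exact hother i (by omega) (by omega)

lemma ae_chain_holding_pos (hS : IsInvariant D ρ S) (n : ℕ) {x : State} (hxS : x.level ∈ S)
    (hx : ResidualPos x) : ∀ᵐ ξ ∂(Measure.infinitePi fun _ : ℕ => D.innovationLaw),
      0 < D.holding ρ (chain D ρ x ξ n) (ξ n) := by
  have hm : ∀ (y : State) n, MeasurableSet {ξ | 0 < D.holding ρ (chain D ρ y ξ n) (ξ n)} :=
    fun y n => measurableSet_lt measurable_const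
      (measurable_holding D ρ (measurable_chain D ρ measurable_const measurable_id n)
        (measurable_pi_apply n))
  refine ae_seqCons _ (hm x n) ?_
  induction n generalizing x with
  | zero =>
    filter_upwards [ae_holding_pos (D := D) (ρ := ρ) hx] with a ha
    exact ae_of_all _ fun ξ => ha
  | succ n ih =>
    filter_upwards [ae_residualPos_next hS hxS hx] with a ha
    filter_upwards [ae_seqCons _ (hm _ n) (ih (next_level_mem hS hxS a) ha)] with ξ hξ
    rw [chain_seqCons_succ]
    exact hξ

lemma ae_holding_state_pos (hS : IsInvariant D ρ S) {n₀ : ℤ} (hn₀ : n₀ ∈ S) :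
    ∀ᵐ ω ∂D.driverLaw, ∀ n, 0 < D.holding ρ (D.state ρ n₀ ω n) (ω.2 n) := by
  rw [ae_all_iff]
  intro n
  have hm : MeasurableSet {ω : Driver | 0 < D.holding ρ (D.state ρ n₀ ω n) (ω.2 n)} :=
    measurableSet_lt measurable_const (measurable_holding D ρ (measurable_state D ρ n₀ n)
      ((measurable_pi_apply n).comp measurable_snd))
  rw [Params.driverLaw, Measure.ae_prod_iff_ae_ae hm]
  filter_upwards [ae_works_pos D] with w hw
  simp_rw [state_eq_chain]
  exact ae_chain_holding_pos hS n hn₀ fun i _ => ⟨ENNReal.coe_pos.2 (hw i), ENNReal.coe_ne_top⟩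

end Positivity

/-! ### Paths -/

section Paths

variable {D : Params} {ρ : Rules} {n₀ : ℤ} {ω : Driver}

/-- Event times tend to infinity and are distinct as long as they are finite. -/
def Regular (D : Params) (ρ : Rules) (n₀ : ℤ) (ω : Driver) : Prop :=
  Tendsto (fun n => (D.state ρ n₀ ω n).time) atTop (𝓝 ⊤) ∧
    ∀ n, 0 < D.holding ρ (D.state ρ n₀ ω n) (ω.2 n)

lemma time_succ (n : ℕ) : (D.state ρ n₀ ω (n + 1)).time =
    (D.state ρ n₀ ω n).time + D.holding ρ (D.state ρ n₀ ω n) (ω.2 n) :=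
  next_time D ρ _ _

lemma monotone_time : Monotone fun n => (D.state ρ n₀ ω n).time :=
  monotone_nat_of_le_succ fun n => by rw [time_succ]; exact le_self_add

lemma path_eq {n : ℕ} {t : ℝ≥0} (h1 : (D.state ρ n₀ ω n).time ≤ t)
    (h2 : t < (D.state ρ n₀ ω (n + 1)).time) : D.path ρ n₀ ω t = (D.state ρ n₀ ω n).level := by
  have h : IsGreatest {m : ℕ | (D.state ρ n₀ ω m).time ≤ t} n := by
    refine ⟨h1, fun m hm => ?_⟩
    by_contra hnm
    exact absurd (h2.trans_le (monotone_time (by omega : n + 1 ≤ m))) (not_lt.2 hm)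
  rw [Params.path, h.csSup_eq]

lemma exists_index_of_lt {n : ℕ} {t : ℝ≥0} (h : t < (D.state ρ n₀ ω (n + 1)).time) :
    ∃ m ≤ n, (D.state ρ n₀ ω m).time ≤ t ∧ t < (D.state ρ n₀ ω (m + 1)).time := by
  induction n with
  | zero => exact ⟨0, le_rfl, by simp [Params.state], h⟩
  | succ n ih =>
    rcases le_or_gt (D.state ρ n₀ ω (n + 1)).time t with h1 | h1
    · exact ⟨n + 1, le_rfl, h1, h⟩
    · obtain ⟨m, hm, h2⟩ := ih h1
      exact ⟨m, by omega, h2⟩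

lemma Regular.exists_index (h : Regular D ρ n₀ ω) (t : ℝ≥0) :
    ∃ n, (D.state ρ n₀ ω n).time ≤ t ∧ t < (D.state ρ n₀ ω (n + 1)).time := by
  have h1 := h.1.eventually (lt_mem_nhds (ENNReal.coe_lt_top (r := t)))
  obtain ⟨n, hn⟩ := h1.exists
  obtain ⟨m, -, hm⟩ := exists_index_of_lt (hn.trans_le (monotone_time (Nat.le_succ n)))
  exact ⟨m, hm⟩

/-- Positive holding times mean that each state reached by time `t` is held on a nondegenerate
interval, so none is hidden by a simultaneous later event. Statements on the infimum of the path
become statements on finitely many levels of the chain. -/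
lemma Regular.image_path (h : Regular D ρ n₀ ω) {n : ℕ} {t : ℝ≥0}
    (h1 : (D.state ρ n₀ ω n).time ≤ t) (h2 : t < (D.state ρ n₀ ω (n + 1)).time) :
    D.path ρ n₀ ω '' Icc 0 t = (fun i => (D.state ρ n₀ ω i).level) '' Iic n := by
  ext j
  constructor
  · rintro ⟨u, ⟨-, hu⟩, rfl⟩
    obtain ⟨m, hm, h3, h4⟩ := exists_index_of_lt ((ENNReal.coe_le_coe.2 hu).trans_lt h2)
    exact ⟨m, hm, (path_eq h3 h4).symm⟩
  · rintro ⟨m, hm, rfl⟩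
    have h3 : (D.state ρ n₀ ω m).time ≤ t := (monotone_time hm).trans h1
    have h4 : (D.state ρ n₀ ω m).time ≠ ⊤ := ne_top_of_le_ne_top ENNReal.coe_ne_top h3
    have h5 : ((D.state ρ n₀ ω m).time.toNNReal : ℝ≥0∞) = (D.state ρ n₀ ω m).time :=
      ENNReal.coe_toNNReal h4
    refine ⟨(D.state ρ n₀ ω m).time.toNNReal, ⟨zero_le, ?_⟩, path_eq h5.ge ?_⟩
    · exact ENNReal.coe_le_coe.1 (h5.trans_le h3)
    · rw [h5, time_succ]
      exact ENNReal.lt_add_right h4 (h.2 m).ne'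

lemma Regular.finite_image (h : Regular D ρ n₀ ω) (t : ℝ≥0) :
    (D.path ρ n₀ ω '' Icc 0 t).Finite := by
  obtain ⟨n, h1, h2⟩ := h.exists_index t
  rw [h.image_path h1 h2]
  exact (finite_Iic n).image _

lemma Regular.exists_isLeast (h : Regular D ρ n₀ ω) (t : ℝ≥0) :
    ∃ l, IsLeast (D.path ρ n₀ ω '' Icc 0 t) l :=
  ⟨_, (h.finite_image t).isCompact.isLeast_sInf ⟨_, mem_image_of_mem _ ⟨zero_le, le_rfl⟩⟩⟩

lemma Regular.rightCont (h : Regular D ρ n₀ ω) (t : ℝ≥0) :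
    ContinuousWithinAt (D.path ρ n₀ ω) (Ici t) t := by
  obtain ⟨n, h1, h2⟩ := h.exists_index t
  have h3 : ∀ᶠ s in 𝓝[≥] t, D.path ρ n₀ ω s = D.path ρ n₀ ω t := by
    have h4 : ∀ᶠ s : ℝ≥0 in 𝓝[≥] t, (s : ℝ≥0∞) < (D.state ρ n₀ ω (n + 1)).time :=
      nhdsWithin_le_nhds ((ENNReal.continuous_coe.tendsto t).eventually (gt_mem_nhds h2))
    filter_upwards [h4, self_mem_nhdsWithin] with s hs hts
    rw [path_eq h1 h2, path_eq (h1.trans (ENNReal.coe_le_coe.2 hts)) hs]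
  exact tendsto_nhds_of_eventually_eq h3

lemma ae_regular {S : Set ℤ} (hS : IsInvariant D ρ S) (hn₀ : n₀ ∈ S)
    (hne : D.NonExplosive ρ n₀) : ∀ᵐ ω ∂D.driverLaw, Regular D ρ n₀ ω := by
  filter_upwards [hne, ae_holding_state_pos hS hn₀] with ω h1 h2
  exact ⟨h1, h2⟩

lemma path_mem {S : Set ℤ} (hS : IsInvariant D ρ S) (hn₀ : n₀ ∈ S) (t : ℝ≥0) :
    D.path ρ n₀ ω t ∈ S := by
  rw [Params.path, state_eq_chain]
  exact chain_level_mem hS hn₀ _ _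

/-- Two systems that agree above level zero have the same path until level zero is reached. -/
lemma state_eq_of_pos {ρ' : Rules} (hρ : AgreesAbove D ρ) (hρ' : AgreesAbove D ρ') (n : ℕ)
    (h : ∀ i ≤ n, 0 < (D.state ρ n₀ ω i).level) :
    D.state ρ' n₀ ω n = D.state ρ n₀ ω n ∧
      (D.state ρ' n₀ ω (n + 1)).time = (D.state ρ n₀ ω (n + 1)).time := by
  have key : ∀ n, (∀ i ≤ n, 0 < (D.state ρ n₀ ω i).level) →
      D.state ρ' n₀ ω n = D.state ρ n₀ ω n := by
    intro n
    induction n with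
    | zero => exact fun _ => rfl
    | succ n ih =>
      intro h
      have h1 := ih fun i hi => h i (by omega)
      have h2 := h n (by omega)
      have h3 := h (n + 1) le_rfl
      rw [Params.state] at h3 ⊢
      rw [Params.state, h1]
      set x := D.state ρ n₀ ω n
      have hh := holding_congr hρ hρ' (x := x) (y := x) ⟨h2, rfl, fun _ _ => rfl⟩ (ω.2 n)
      have hw : D.workBefore ρ' x (ω.2 n) = D.workBefore ρ x (ω.2 n) := by
        unfold Params.workBefore
        rw [hh, hρ.speed_eq _ h2, hρ'.speed_eq _ h2]
      unfold Params.next at h3 ⊢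
      rw [hh, hw]
      dsimp only at h3 ⊢
      split_ifs at h3 ⊢ with g1 g2 g3
      · rfl
      · rfl
      · rcases le_or_gt (x.level - (ω.2 n).removed x.level) 0 with h4 | h4
        · exact absurd h3 (not_lt.2 (hρ.catTarget_nonpos _ h4))
        · rw [hρ.catTarget_eq _ h4, hρ'.catTarget_eq _ h4]
      · rfl
  -- The event that ends the agreement still occurs at a common time, since the holding time depends
  -- on the state before it.
  refine ⟨key n h, ?_⟩
  rw [time_succ, time_succ, key n h, holding_congr hρ hρ' ⟨h n le_rfl, rfl, fun _ _ => rfl⟩]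

lemma Regular.path_eq_of_pos {ρ' : Rules} (hω : Regular D ρ n₀ ω) (hρ : AgreesAbove D ρ)
    (hρ' : AgreesAbove D ρ') {t : ℝ≥0} (h : ∀ u ≤ t, 0 < D.path ρ n₀ ω u) {u : ℝ≥0} (hu : u ≤ t) :
    D.path ρ' n₀ ω u = D.path ρ n₀ ω u := by
  obtain ⟨n, h1, h2⟩ := hω.exists_index u
  have h3 : ∀ i ≤ n, 0 < (D.state ρ n₀ ω i).level := by
    intro i hi
    have h4 : (D.state ρ n₀ ω i).level ∈ D.path ρ n₀ ω '' Icc 0 u := by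
      rw [hω.image_path h1 h2]
      exact ⟨i, hi, rfl⟩
    obtain ⟨v, hv, hv'⟩ := h4
    rw [← hv']
    exact h v (hv.2.trans hu)
  obtain ⟨h5, h6⟩ := state_eq_of_pos hρ hρ' n h3
  rw [path_eq h1 h2, path_eq (h5 ▸ h1) (h6 ▸ h2), h5]

lemma measurable_path : Measurable (D.path ρ n₀) := by
  rw [measurable_pi_iff]
  intro t
  refine measurable_to_countable' fun m => ?_
  have hT : ∀ n, Measurable fun ω => (D.state ρ n₀ ω n).time := fun n =>
    measurable_time.comp (measurable_state D ρ n₀ n)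
  have h1 : (fun ω => D.path ρ n₀ ω t) ⁻¹' {m} =
      (⋃ n, {ω | (D.state ρ n₀ ω n).time ≤ t} ∩ {ω | t < (D.state ρ n₀ ω (n + 1)).time} ∩
        {ω | (D.state ρ n₀ ω n).level = m}) ∪
      (⋂ n, {ω | (D.state ρ n₀ ω n).time ≤ t}) ∩ {_ω | n₀ = m} := by
    ext ω
    simp only [mem_preimage, mem_singleton_iff, mem_union, mem_iUnion, mem_inter_iff,
      mem_ofPred_eq, mem_iInter]
    by_cases h : ∃ n, t < (D.state ρ n₀ ω (n + 1)).time
    · obtain ⟨n, hn⟩ := h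
      obtain ⟨i, -, h2, h3⟩ := exists_index_of_lt hn
      constructor
      · intro h4
        exact Or.inl ⟨i, ⟨h2, h3⟩, by rw [← path_eq h2 h3, h4]⟩
      · rintro (⟨j, ⟨h4, h5⟩, h6⟩ | ⟨h4, -⟩)
        · rw [path_eq h4 h5, h6]
        · exact absurd (h4 (i + 1)) (not_le.2 h3)
    -- If infinitely many events occur up to `t`, the index set is all of `ℕ`; its `sSup` is 0 by
    -- convention, and the path is at `n₀`.
    · push Not at h
      have h4 : {n : ℕ | (D.state ρ n₀ ω n).time ≤ t} = univ := by
        ext n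
        simp only [mem_ofPred_eq, mem_univ, iff_true]
        exact (monotone_time (Nat.le_succ n)).trans (h n)
      have h5 : D.path ρ n₀ ω t = n₀ := by
        rw [Params.path, h4]
        simp [Params.state]
      rw [h5]
      constructor
      · intro h6
        exact Or.inr ⟨fun n => (monotone_time (Nat.le_succ n)).trans (h n), h6⟩
      · rintro (⟨n, ⟨-, h6⟩, -⟩ | ⟨-, h6⟩)
        · exact absurd (h n) (not_le.2 h6)
        · exact h6
  rw [h1]
  refine (MeasurableSet.iUnion fun n => ?_).union
    ((MeasurableSet.iInter fun n => measurableSet_le (hT n) measurable_const).inter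
      (MeasurableSet.const _))
  exact ((measurableSet_le (hT n) measurable_const).inter
    (measurableSet_lt measurable_const (hT _))).inter
    (measurable_level.comp (measurable_state D ρ n₀ n) (measurableSet_singleton m))

end Paths

/-! ### The position at an independent exponential time -/

section Canonical

variable {D : Params} {ρ : Rules} {n₀ : ℤ} {q : ℝ}

/-- The joint law of an exponential time and the independent driving randomness. -/
def killedLaw (D : Params) (q : ℝ) : Measure (ℝ≥0 × Driver) := (expNN q).prod D.driverLaw

lemma isProbabilityMeasure_killedLaw (D : Params) (hq : 0 < q) :
    IsProbabilityMeasure (killedLaw D q) := by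
  have := isProbabilityMeasure_expNN hq
  unfold killedLaw
  infer_instance

lemma ae_killedLaw (hq : 0 < q) {p : Driver → Prop} (h : ∀ᵐ ω ∂D.driverLaw, p ω) :
    ∀ᵐ z ∂killedLaw D q, p z.2 := by
  have := isProbabilityMeasure_expNN hq
  exact Measure.quasiMeasurePreserving_snd.ae h

/-- The time lies between the `n`-th and the next event, the level is `m` then, and the earlier
levels are in `A`. -/
def ringEvent (D : Params) (ρ : Rules) (n₀ : ℤ) (A : Set ℤ) (m : ℤ) (n : ℕ) :
    Set (ℝ≥0 × Driver) :=
  {z | ((D.state ρ n₀ z.2 n).time ≤ z.1 ∧ z.1 < (D.state ρ n₀ z.2 (n + 1)).time) ∧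
    (D.state ρ n₀ z.2 n).level = m ∧ ∀ i < n, (D.state ρ n₀ z.2 i).level ∈ A}

lemma measurableSet_ringEvent (A : Set ℤ) (m : ℤ) (n : ℕ) :
    MeasurableSet (ringEvent D ρ n₀ A m n) := by
  have hs : ∀ n, Measurable fun z : ℝ≥0 × Driver => D.state ρ n₀ z.2 n := fun n =>
    (measurable_state D ρ n₀ n).comp measurable_snd
  have ht : Measurable fun z : ℝ≥0 × Driver => (z.1 : ℝ≥0∞) :=
    measurable_coe_nnreal_ennreal.comp measurable_fst
  have hl : ∀ n, Measurable fun z : ℝ≥0 × Driver => (D.state ρ n₀ z.2 n).level := fun n =>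
    measurable_level.comp (hs n)
  have h1 : MeasurableSet {z : ℝ≥0 × Driver | ∀ i < n, (D.state ρ n₀ z.2 i).level ∈ A} := by
    simp only [ofPred_forall]
    exact MeasurableSet.iInter fun i => MeasurableSet.iInter fun _ =>
      hl i (MeasurableSet.of_discrete (s := A))
  exact ((measurableSet_le (measurable_time.comp (hs n)) ht).inter
    (measurableSet_lt ht (measurable_time.comp (hs (n + 1))))).inter
    ((hl n (measurableSet_singleton m)).inter h1)

lemma pairwise_disjoint_ringEvent (A : Set ℤ) (m : ℤ) :
    Pairwise (Function.onFun Disjoint (ringEvent D ρ n₀ A m)) := by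
  have h : ∀ i j, i < j → Disjoint (ringEvent D ρ n₀ A m i) (ringEvent D ρ n₀ A m j) := by
    intro i j hij
    rw [Set.disjoint_left]
    rintro z ⟨⟨-, h1⟩, -⟩ ⟨⟨h2, -⟩, -⟩
    exact absurd (h1.trans_le (monotone_time (by omega : i + 1 ≤ j))) (not_lt.2 h2)
  intro i j hij
  rcases lt_or_gt_of_ne hij with h1 | h1
  · exact h i j h1
  · exact (h j i h1).symm

/-- Integrate over the exponential time first. For a given driver the interval between the two
events has mass `disc q T * (1 - disc q h)`, with `T` the time of the `n`-th event and `h` the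
holding time; this is a functional of the form treated by `lintegral_chain`. -/
lemma killedLaw_ringEvent (hq : 0 < q) (A : Set ℤ) (m : ℤ) (n : ℕ) :
    killedLaw D q (ringEvent D ρ n₀ A m n) =
      ∫⁻ w, (killedStep D ρ q A)^[n] (indicator (State.level ⁻¹' {m}) (ringProb D ρ q))
        (initState n₀ w) ∂(Measure.infinitePi fun j => (D.workLaw j : Measure ℝ≥0)) := by
  have := isProbabilityMeasure_expNN hq
  set g : State → Innovation → ℝ≥0∞ := fun x ξ =>
    indicator (State.level ⁻¹' {m}) (fun x => 1 - disc q (D.holding ρ x ξ)) x with hg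
  have hgm : Measurable (Function.uncurry g) := by
    have h : Function.uncurry g = indicator ((fun p : State × Innovation => p.1.level) ⁻¹' {m})
        (fun p => 1 - disc q (D.holding ρ p.1 p.2)) := by
      ext ⟨x, ξ⟩
      rfl
    rw [h]
    exact (measurable_const.sub measurable_disc_holding).indicator
      ((measurable_level.comp measurable_fst) (measurableSet_singleton m))
  have hgi : (fun y => ∫⁻ ξ, g y ξ ∂D.innovationLaw) =
      indicator (State.level ⁻¹' {m}) (ringProb D ρ q) := by
    ext y
    by_cases hy : y ∈ State.level ⁻¹' {m}
    · simp only [hg, indicator_of_mem hy]; rfl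
    · simp only [hg, indicator_of_notMem hy, lintegral_zero]
  have hfib : ∀ ω : Driver, expNN q ((fun t => (t, ω)) ⁻¹' ringEvent D ρ n₀ A m n) =
      indicator {ξ | ∀ i < n, (chain D ρ (initState n₀ ω.1) ξ i).level ∈ A}
        (fun ξ => disc q (chain D ρ (initState n₀ ω.1) ξ n).time *
          g (chain D ρ (initState n₀ ω.1) ξ n) (ξ n)) ω.2 := by
    intro ω
    by_cases h1 : ∀ i < n, (D.state ρ n₀ ω i).level ∈ A
    · have h1' : ω.2 ∈ {ξ | ∀ i < n, (chain D ρ (initState n₀ ω.1) ξ i).level ∈ A} := by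
        intro i hi
        rw [← state_eq_chain]
        exact h1 i hi
      rw [indicator_of_mem h1', ← state_eq_chain]
      by_cases h2 : (D.state ρ n₀ ω n).level = m
      · have h3 : (fun t => (t, ω)) ⁻¹' ringEvent D ρ n₀ A m n =
            {t : ℝ≥0 | (D.state ρ n₀ ω n).time ≤ t ∧ t < (D.state ρ n₀ ω (n + 1)).time} := by
          ext t
          exact ⟨fun h => h.1, fun h => ⟨h, h2, h1⟩⟩
        have h4 : D.state ρ n₀ ω n ∈ State.level ⁻¹' {m} := h2
        have h5 : (D.state ρ n₀ ω n).time ≤ (D.state ρ n₀ ω (n + 1)).time :=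
          monotone_time (Nat.le_succ n)
        rw [h3, expNN_Ico hq h5, time_succ, disc_add]
        simp only [hg, indicator_of_mem h4]
        rw [ENNReal.mul_sub (fun _ _ => ne_top_of_le_ne_top ENNReal.one_ne_top
          (disc_le_one hq.le _)), mul_one]
      · have h3 : (fun t => (t, ω)) ⁻¹' ringEvent D ρ n₀ A m n = ∅ := by
          ext t
          exact ⟨fun h => h2 h.2.1, fun h => h.elim⟩
        have h4 : D.state ρ n₀ ω n ∉ State.level ⁻¹' {m} := h2
        rw [h3]
        simp only [hg, indicator_of_notMem h4, measure_empty, mul_zero]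
    · have h1' : ω.2 ∉ {ξ | ∀ i < n, (chain D ρ (initState n₀ ω.1) ξ i).level ∈ A} := by
        intro h
        refine h1 fun i hi => ?_
        rw [state_eq_chain]
        exact h i hi
      have h3 : (fun t => (t, ω)) ⁻¹' ringEvent D ρ n₀ A m n = ∅ := by
        ext t
        exact ⟨fun h => h1 h.2.2, fun h => h.elim⟩
      rw [indicator_of_notMem h1', h3, measure_empty]
  have hmeas : Measurable fun ω : Driver =>
      expNN q ((fun t => (t, ω)) ⁻¹' ringEvent D ρ n₀ A m n) :=
    measurable_measure_prodMk_right (measurableSet_ringEvent A m n)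
  rw [killedLaw, Measure.prod_apply_symm (measurableSet_ringEvent A m n), Params.driverLaw,
    lintegral_prod _ hmeas.aemeasurable]
  congr 1 with w
  simp_rw [hfib]
  rw [lintegral_chain A hgm n (initState n₀ w), hgi]
  simp [initState]

lemma killedLaw_iUnion_ringEvent (hq : 0 < q) (A : Set ℤ) (m : ℤ) :
    killedLaw D q (⋃ n, ringEvent D ρ n₀ A m n) =
      ∫⁻ w, ∑' n, (killedStep D ρ q A)^[n] (indicator (State.level ⁻¹' {m}) (ringProb D ρ q))
        (initState n₀ w) ∂(Measure.infinitePi fun j => (D.workLaw j : Measure ℝ≥0)) := by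
  rw [measure_iUnion (pairwise_disjoint_ringEvent A m) (measurableSet_ringEvent A m), lintegral_tsum]
  · exact tsum_congr fun n => killedLaw_ringEvent hq A m n
  · exact fun n => ((measurable_iterate_killedStep A
      (measurable_ringProb.indicator (measurable_preimage_level _)) n).comp
        (measurable_initState n₀)).aemeasurable

/-- By regularity, path values up to the time are chain levels up to the current index. `ringEvent`
restricts only the earlier levels to `A`; the current one is `m`, which lies in `A` by `hm`. -/
lemma mem_iUnion_ringEvent_iff {A : Set ℤ} {m : ℤ} (hm : m ∈ A) {z : ℝ≥0 × Driver}
    (hz : Regular D ρ n₀ z.2) : z ∈ ⋃ n, ringEvent D ρ n₀ A m n ↔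
      D.path ρ n₀ z.2 z.1 = m ∧ ∀ u ≤ z.1, D.path ρ n₀ z.2 u ∈ A := by
  have himg : ∀ n, (D.state ρ n₀ z.2 n).time ≤ z.1 → z.1 < (D.state ρ n₀ z.2 (n + 1)).time →
      ((∀ u ≤ z.1, D.path ρ n₀ z.2 u ∈ A) ↔ ∀ i ≤ n, (D.state ρ n₀ z.2 i).level ∈ A) := by
    intro n h1 h2
    have h3 := hz.image_path h1 h2
    constructor
    · intro h i hi
      have h4 : (D.state ρ n₀ z.2 i).level ∈ D.path ρ n₀ z.2 '' Icc 0 z.1 := by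
        rw [h3]; exact ⟨i, hi, rfl⟩
      obtain ⟨u, hu, hu'⟩ := h4
      rw [← hu']
      exact h u hu.2
    · intro h u hu
      have h4 : D.path ρ n₀ z.2 u ∈ (fun i => (D.state ρ n₀ z.2 i).level) '' Iic n := by
        rw [← h3]; exact ⟨u, ⟨zero_le, hu⟩, rfl⟩
      obtain ⟨i, hi, hi'⟩ := h4
      rw [← hi']
      exact h i hi
  constructor
  · intro h
    obtain ⟨n, ⟨h1, h2⟩, h3, h4⟩ := mem_iUnion.1 h
    refine ⟨by rw [path_eq h1 h2, h3], (himg n h1 h2).2 fun i hi => ?_⟩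
    rcases hi.lt_or_eq with h5 | rfl
    · exact h4 i h5
    · rwa [h3]
  · rintro ⟨h1, h2⟩
    obtain ⟨n, h3, h4⟩ := hz.exists_index z.1
    exact mem_iUnion.2 ⟨n, ⟨h3, h4⟩, by rw [← h1, path_eq h3 h4],
      fun i hi => (himg n h3 h4).1 h2 i hi.le⟩

/-- At the exponential time the level is `m`, and the least level so far is `l`. -/
def levelEvent (D : Params) (ρ : Rules) (n₀ l m : ℤ) : Set (ℝ≥0 × Driver) :=
  {z | D.path ρ n₀ z.2 z.1 = m ∧ IsLeast (D.path ρ n₀ z.2 '' Icc 0 z.1) l}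

lemma killedLaw_levelEvent_zero_zero (hq : 0 < q)
    (hreg : ∀ᵐ ω ∂D.driverLaw, Regular D ρ n₀ ω) :
    killedLaw D q (levelEvent D ρ n₀ 0 0) =
      killedLaw D q (⋃ n, ringEvent D ρ n₀ (Ici 0) 0 n) := by
  apply measure_congr
  filter_upwards [ae_killedLaw hq hreg] with z hz
  refine eq_iff_iff.2 (Iff.trans ?_ (mem_iUnion_ringEvent_iff (m := 0) self_mem_Ici hz).symm)
  constructor
  · rintro ⟨h1, h2⟩
    exact ⟨h1, fun u hu => h2.2 ⟨u, ⟨zero_le, hu⟩, rfl⟩⟩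
  · rintro ⟨h1, h2⟩
    refine ⟨h1, ⟨z.1, ⟨zero_le, le_rfl⟩, h1⟩, ?_⟩
    rintro _ ⟨u, hu, rfl⟩
    exact h2 u hu.2

/-- The probability to be at level `k` above the current minimum zero is a multiple of the
probability to be at the current minimum zero; the factor is the same for all rules that agree
above level zero. -/
lemma killedLaw_levelEvent_zero {k : ℤ} (hk : 0 < k) (hq : 0 < q) (hρ : AgreesAbove D ρ)
    (hreg : ∀ᵐ ω ∂D.driverLaw, Regular D ρ n₀ ω) :
    killedLaw D q (levelEvent D ρ n₀ 0 k) =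
      excursionRatio D q k * killedLaw D q (levelEvent D ρ n₀ 0 0) := by
  have := isProbabilityMeasure_killedLaw D hq
  set E := ⋃ n, ringEvent D ρ n₀ (Ici 0) k n with hE
  set F := ⋃ n, ringEvent D ρ n₀ (Ioi 0) k n with hF
  have hFm : MeasurableSet F := MeasurableSet.iUnion fun n => measurableSet_ringEvent _ _ n
  -- Among the paths that stay nonnegative and end at `k`, those in `F` never touch zero, and the
  -- others have minimum exactly zero.
  have hsplit : killedLaw D q F + killedLaw D q (levelEvent D ρ n₀ 0 k) = killedLaw D q E := by
    rw [← measure_inter_add_sdiff E hFm]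
    congr 1
    · apply measure_congr
      filter_upwards [ae_killedLaw hq hreg] with z hz
      have hFz := mem_iUnion_ringEvent_iff (A := Ioi 0) (mem_Ioi.2 hk) hz
      have hEz := mem_iUnion_ringEvent_iff (A := Ici 0) (mem_Ici.2 hk.le) hz
      rw [← hF] at hFz
      rw [← hE] at hEz
      exact eq_iff_iff.2 ⟨fun h => ⟨hEz.2 ⟨(hFz.1 h).1, fun u hu =>
          Ioi_subset_Ici_self ((hFz.1 h).2 u hu)⟩, h⟩,
        fun h => h.2⟩
    · apply measure_congr
      filter_upwards [ae_killedLaw hq hreg] with z hz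
      have hFz := mem_iUnion_ringEvent_iff (A := Ioi 0) (mem_Ioi.2 hk) hz
      have hEz := mem_iUnion_ringEvent_iff (A := Ici 0) (mem_Ici.2 hk.le) hz
      rw [← hF] at hFz
      rw [← hE] at hEz
      refine eq_iff_iff.2 ⟨fun h => ⟨hEz.2 ⟨h.1, fun u hu => h.2.2 ⟨u, ⟨zero_le, hu⟩, rfl⟩⟩, ?_⟩, ?_⟩
      · intro hzF
        obtain ⟨u, hu, hu'⟩ := h.2.1
        exact absurd ((hFz.1 hzF).2 u hu.2) (by rw [hu']; simp)
      · rintro ⟨h1, h2⟩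
        obtain ⟨h3, h4⟩ := hEz.1 h1
        refine ⟨h3, ?_, ?_⟩
        · by_contra h5
          refine h2 (hFz.2 ⟨h3, fun u hu => mem_Ioi.2 (lt_of_le_of_ne (h4 u hu)
            fun h6 => h5 ?_)⟩)
          exact ⟨u, ⟨zero_le, hu⟩, h6.symm⟩
        · rintro _ ⟨u, hu, rfl⟩
          exact h4 u hu.2
  -- The decomposition at the last visit to zero has the same first term, which is finite and
  -- cancels against `hsplit`.
  have hE2 : killedLaw D q E = killedLaw D q F +
      excursionRatio D q k * killedLaw D q (levelEvent D ρ n₀ 0 0) := by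
    rw [killedLaw_levelEvent_zero_zero hq hreg, hE, hF, killedLaw_iUnion_ringEvent hq,
      killedLaw_iUnion_ringEvent hq, killedLaw_iUnion_ringEvent hq]
    have hm : ∀ (A : Set ℤ) (j : ℤ), Measurable fun w => ∑' n, (killedStep D ρ q A)^[n]
        (indicator (State.level ⁻¹' {j}) (ringProb D ρ q)) (initState n₀ w) := fun A j =>
      Measurable.tsum fun n => (measurable_iterate_killedStep A
        (measurable_ringProb.indicator (measurable_preimage_level _)) n).comp
          (measurable_initState n₀)
    rw [← lintegral_const_mul _ (hm _ _), ← lintegral_add_left (hm _ _)]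
    congr 1 with w
    exact tsum_visits_eq D hk hq hρ _
  rw [hE2] at hsplit
  exact (ENNReal.add_right_inj (measure_ne_top _ _)).1 hsplit

/-- As long as the minimum is positive, the system and its reflection coincide. -/
lemma levelEvent_subset_of_pos {ρ' : Rules} {l m : ℤ} (hl : 0 < l) (hρ : AgreesAbove D ρ)
    (hρ' : AgreesAbove D ρ') {z : ℝ≥0 × Driver} (hz : Regular D ρ n₀ z.2)
    (h : z ∈ levelEvent D ρ n₀ l m) : z ∈ levelEvent D ρ' n₀ l m := by
  have hpos : ∀ u ≤ z.1, 0 < D.path ρ n₀ z.2 u := fun u hu =>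
    hl.trans_le (h.2.2 ⟨u, ⟨zero_le, hu⟩, rfl⟩)
  have heq : ∀ u ∈ Icc 0 z.1, D.path ρ' n₀ z.2 u = D.path ρ n₀ z.2 u := fun u hu =>
    hz.path_eq_of_pos hρ hρ' hpos hu.2
  refine ⟨by rw [heq z.1 ⟨zero_le, le_rfl⟩, h.1], ?_⟩
  rw [image_congr heq]
  exact h.2

lemma killedLaw_levelEvent_pos {ρ' : Rules} {l : ℤ} (hl : 0 < l) (m : ℤ) (hq : 0 < q)
    (hρ : AgreesAbove D ρ) (hρ' : AgreesAbove D ρ')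
    (hreg : ∀ᵐ ω ∂D.driverLaw, Regular D ρ n₀ ω) (hreg' : ∀ᵐ ω ∂D.driverLaw, Regular D ρ' n₀ ω) :
    killedLaw D q (levelEvent D ρ n₀ l m) = killedLaw D q (levelEvent D ρ' n₀ l m) := by
  apply measure_congr
  filter_upwards [ae_killedLaw hq hreg, ae_killedLaw hq hreg'] with z h1 h2
  exact eq_iff_iff.2 ⟨fun h => levelEvent_subset_of_pos hl hρ hρ' h1 h,
    fun h => levelEvent_subset_of_pos hl hρ' hρ h2 h⟩

/-- If the minimum of the system is zero, then so is that of its reflection. -/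
lemma killedLaw_minimum_zero_le (hn₀ : 0 ≤ n₀) (hq : 0 < q)
    (hreg : ∀ᵐ ω ∂D.driverLaw, Regular D (D.reflected 0) n₀ ω) :
    killedLaw D q (⋃ m, levelEvent D D.free n₀ 0 m) ≤
      killedLaw D q (⋃ m, levelEvent D (D.reflected 0) n₀ 0 m) := by
  apply measure_mono_ae
  filter_upwards [ae_killedLaw hq hreg] with z hz h
  obtain ⟨m, -, h1⟩ := mem_iUnion.1 h
  obtain ⟨u, hu, hu'⟩ := h1.1
  have hnn : ∀ v, 0 ≤ D.path (D.reflected 0) n₀ z.2 v := fun v =>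
    path_mem (isInvariant_reflected D) hn₀ v
  -- Had the reflected path stayed positive, the free path would coincide with it and could not
  -- vanish at `u`.
  have hex : ∃ v ≤ z.1, D.path (D.reflected 0) n₀ z.2 v = 0 := by
    by_contra! h2
    have hpos : ∀ v ≤ z.1, 0 < D.path (D.reflected 0) n₀ z.2 v := fun v hv =>
      lt_of_le_of_ne (hnn v) (h2 v hv).symm
    have h3 := hz.path_eq_of_pos (agreesAbove_reflected D) (agreesAbove_free D) hpos hu.2
    exact h2 u hu.2 (h3.symm.trans hu')
  obtain ⟨v, hv, hv0⟩ := hex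
  refine mem_iUnion.2 ⟨_, rfl, ⟨v, ⟨zero_le, hv⟩, hv0⟩, ?_⟩
  rintro _ ⟨v, -, rfl⟩
  exact hnn v

end Canonical

/-! ### Versions of the level process -/

section Versions

/-- A point of the grid of width `1 / (n + 1)` that lies to the right of `t`. -/
def gridRight (n : ℕ) (t : ℝ≥0) : ℝ≥0 := ((⌊(n + 1) * t⌋₊ : ℝ≥0) + 1) / (n + 1)

lemma le_gridRight (n : ℕ) (t : ℝ≥0) : t ≤ gridRight n t := by
  rw [gridRight, le_div_iff₀ (by positivity), mul_comm]
  exact (Nat.lt_floor_add_one _).le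

lemma gridRight_le (n : ℕ) (t : ℝ≥0) : gridRight n t ≤ t + 1 / (n + 1) := by
  rw [gridRight, add_div]
  gcongr
  rw [div_le_iff₀ (by positivity), mul_comm]
  exact Nat.floor_le zero_le

lemma tendsto_gridRight (t : ℝ≥0) : Tendsto (fun n => gridRight n t) atTop (𝓝[≥] t) := by
  refine tendsto_nhdsWithin_iff.2 ⟨?_, Eventually.of_forall fun n => le_gridRight n t⟩
  have h : Tendsto (fun n : ℕ => t + 1 / ((n : ℝ≥0) + 1)) atTop (𝓝 (t + 0)) :=
    tendsto_const_nhds.add tendsto_one_div_add_atTop_nhds_zero_nat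
  rw [add_zero] at h
  exact tendsto_of_tendsto_of_tendsto_of_le_of_le tendsto_const_nhds h
    (fun n => le_gridRight n t) (fun n => gridRight_le n t)

/-- Evaluation of a path at a variable time is not measurable for the product `σ`-algebra. Grid
points take countably many values, and right-continuity recovers the value at the time itself in the
limit. -/
lemma measurable_eval_gridRight (n : ℕ) :
    Measurable fun p : ℝ≥0 × (ℝ≥0 → ℤ) => p.2 (gridRight n p.1) := by
  have h1 : Measurable fun p : ℕ × (ℝ≥0 → ℤ) => p.2 (((p.1 : ℝ≥0) + 1) / (n + 1)) :=
    measurable_from_prod_countable_right fun k =>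
      measurable_pi_apply (((k : ℝ≥0) + 1) / (n + 1))
  have h2 : Measurable fun p : ℝ≥0 × (ℝ≥0 → ℤ) => ⌊((n : ℝ≥0) + 1) * p.1⌋₊ :=
    Nat.measurable_floor.comp (measurable_const.mul measurable_fst)
  exact h1.comp (h2.prodMk measurable_snd)

/-- A measurable set of times and paths; for a right-continuous path it says that the value at the
time is `m`, and that the least value so far is `l`. -/
def levelSet (l m : ℤ) : Set (ℝ≥0 × (ℝ≥0 → ℤ)) :=
  {p | (∀ᶠ n in atTop, p.2 (gridRight n p.1) = m) ∧ l ≤ m ∧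
    (∀ i, TopologicalSpace.denseSeq ℝ≥0 i < p.1 → l ≤ p.2 (TopologicalSpace.denseSeq ℝ≥0 i)) ∧
    (m = l ∨ ∃ i, TopologicalSpace.denseSeq ℝ≥0 i < p.1 ∧
      p.2 (TopologicalSpace.denseSeq ℝ≥0 i) = l)}

lemma measurableSet_levelSet (l m : ℤ) : MeasurableSet (levelSet l m) := by
  have he : ∀ u : ℝ≥0, Measurable fun p : ℝ≥0 × (ℝ≥0 → ℤ) => p.2 u := fun u =>
    (measurable_pi_apply u).comp measurable_snd
  have hlt : ∀ u : ℝ≥0, MeasurableSet {p : ℝ≥0 × (ℝ≥0 → ℤ) | u < p.1} := fun u =>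
    measurableSet_lt measurable_const measurable_fst
  have h1 : MeasurableSet {p : ℝ≥0 × (ℝ≥0 → ℤ) | ∀ᶠ n in atTop, p.2 (gridRight n p.1) = m} := by
    simp only [eventually_atTop, ofPred_exists, ofPred_forall]
    exact MeasurableSet.iUnion fun _ => MeasurableSet.iInter fun n => MeasurableSet.iInter fun _ =>
      measurable_eval_gridRight n (measurableSet_singleton m)
  have h2 : MeasurableSet {p : ℝ≥0 × (ℝ≥0 → ℤ) | ∀ i, TopologicalSpace.denseSeq ℝ≥0 i < p.1 →
      l ≤ p.2 (TopologicalSpace.denseSeq ℝ≥0 i)} := by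
    rw [ofPred_forall]
    refine MeasurableSet.iInter fun i => ?_
    exact (hlt _).himp (measurableSet_le measurable_const (he _))
  have h3 : MeasurableSet {p : ℝ≥0 × (ℝ≥0 → ℤ) | ∃ i, TopologicalSpace.denseSeq ℝ≥0 i < p.1 ∧
      p.2 (TopologicalSpace.denseSeq ℝ≥0 i) = l} := by
    rw [ofPred_exists]
    exact MeasurableSet.iUnion fun i => (hlt _).inter (he _ (measurableSet_singleton l))
  exact h1.inter ((MeasurableSet.const _).inter (h2.inter ((MeasurableSet.const _).union h3)))

lemma pairwise_disjoint_levelSet (l : ℤ) : Pairwise (Function.onFun Disjoint (levelSet l)) := by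
  intro m m' hm
  rw [Function.onFun, Set.disjoint_left]
  rintro p ⟨h1, -⟩ ⟨h2, -⟩
  obtain ⟨n, h3, h4⟩ := (h1.and h2).exists
  exact hm (h3.symm.trans h4)

/-- An integer-valued right-continuous path holds its value at `u < t` on an interval to the right
of `u`, which contains a point of the dense sequence before `t`. Hence all values before `t` are
seen along that sequence, and only the endpoint `t` needs separate clauses. -/
lemma mem_levelSet_iff {f : ℝ≥0 → ℤ} (hf : ∀ t, ContinuousWithinAt f (Ici t) t) (t : ℝ≥0)
    (l m : ℤ) : (t, f) ∈ levelSet l m ↔ f t = m ∧ IsLeast (f '' Icc 0 t) l := by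
  have hev : ∀ u, ∀ᶠ s in 𝓝[≥] u, f s = f u := fun u =>
    (hf u).eventually (IsOpen.mem_nhds (isOpen_discrete {f u}) rfl)
  have h1 : (∀ᶠ n in atTop, f (gridRight n t) = m) ↔ f t = m := by
    have h := (tendsto_gridRight t).eventually (hev t)
    constructor
    · intro h2
      obtain ⟨n, h3, h4⟩ := (h.and h2).exists
      exact h3.symm.trans h4
    · rintro rfl
      exact h
  have h2 : ∀ u < t, ∃ i, TopologicalSpace.denseSeq ℝ≥0 i < t ∧
      f (TopologicalSpace.denseSeq ℝ≥0 i) = f u := by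
    intro u hu
    obtain ⟨v, hv, hsub⟩ := (mem_nhdsGE_iff_exists_Ico_subset' hu).1 (hev u)
    obtain ⟨s, hs'⟩ := (TopologicalSpace.denseRange_denseSeq ℝ≥0).exists_mem_open
      (isOpen_Ioo (a := u) (b := min v t)) (nonempty_Ioo.2 (lt_min hv hu))
    exact ⟨s, hs'.2.trans_le (min_le_right _ _),
      hsub ⟨le_of_lt hs'.1, hs'.2.trans_le (min_le_left _ _)⟩⟩
  constructor
  · rintro ⟨g1, g2, g3, g4⟩
    have g1' : f t = m := h1.1 g1
    refine ⟨g1', ?_, ?_⟩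
    · rcases g4 with g4 | ⟨i, g4, g5⟩
      · exact ⟨t, ⟨zero_le, le_rfl⟩, g1'.trans g4⟩
      · exact ⟨_, ⟨zero_le, g4.le⟩, g5⟩
    · rintro _ ⟨u, hu, rfl⟩
      rcases hu.2.lt_or_eq with hut | hut
      · obtain ⟨i, g5, g6⟩ := h2 u hut
        have := g3 i g5
        dsimp only at this
        rwa [g6] at this
      · rwa [hut, g1']
  · rintro ⟨g1, ⟨u, hu, g2⟩, g3⟩
    refine ⟨h1.2 g1, g1 ▸ g3 ⟨t, ⟨zero_le, le_rfl⟩, rfl⟩,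
      fun i hi => g3 ⟨_, ⟨zero_le, le_of_lt hi⟩, rfl⟩, ?_⟩
    rcases hu.2.lt_or_eq with hut | hut
    · obtain ⟨i, g5, g6⟩ := h2 u hut
      exact Or.inr ⟨i, g5, g6.trans g2⟩
    · left
      rw [← g1, ← g2, hut]

/-! ### Transfer from the canonical construction to arbitrary versions. -/

variable {D : Params} {ρ : Rules} {n₀ : ℤ} {q : ℝ}

/-- The joint law of an exponential time and an independent path of the level process. -/
def jointLaw (D : Params) (ρ : Rules) (n₀ : ℤ) (q : ℝ) : Measure (ℝ≥0 × (ℝ≥0 → ℤ)) :=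
  (expNN q).prod (D.pathLaw ρ n₀)

lemma map_killedLaw (hq : 0 < q) :
    (killedLaw D q).map (Prod.map id (D.path ρ n₀)) = jointLaw D ρ n₀ q := by
  have := isProbabilityMeasure_expNN hq
  rw [killedLaw, jointLaw, Params.pathLaw, ← Measure.map_prod_map _ _ measurable_id measurable_path,
    Measure.map_id]

lemma jointLaw_levelSet (hq : 0 < q) (hreg : ∀ᵐ ω ∂D.driverLaw, Regular D ρ n₀ ω) (l m : ℤ) :
    jointLaw D ρ n₀ q (levelSet l m) = killedLaw D q (levelEvent D ρ n₀ l m) := by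
  rw [← map_killedLaw hq, Measure.map_apply (measurable_id.prodMap measurable_path)
    (measurableSet_levelSet l m)]
  apply measure_congr
  filter_upwards [ae_killedLaw hq hreg] with z hz
  exact eq_iff_iff.2 (mem_levelSet_iff hz.rightCont z.1 l m)

lemma jointLaw_iUnion_levelSet (hq : 0 < q) (hreg : ∀ᵐ ω ∂D.driverLaw, Regular D ρ n₀ ω) (l : ℤ) :
    jointLaw D ρ n₀ q (⋃ m, levelSet l m) =
      killedLaw D q (⋃ m, levelEvent D ρ n₀ l m) := by
  rw [← map_killedLaw hq, Measure.map_apply (measurable_id.prodMap measurable_path)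
    (MeasurableSet.iUnion fun m => measurableSet_levelSet l m)]
  apply measure_congr
  filter_upwards [ae_killedLaw hq hreg] with z hz
  refine eq_iff_iff.2 ?_
  change _ ∈ (⋃ m, levelSet l m) ↔ z ∈ ⋃ m, levelEvent D ρ n₀ l m
  simp only [mem_iUnion]
  exact exists_congr fun m => mem_levelSet_iff hz.rightCont z.1 l m

lemma ae_jointLaw_mem_levelSet (hq : 0 < q) (hreg : ∀ᵐ ω ∂D.driverLaw, Regular D ρ n₀ ω) :
    ∀ᵐ p ∂jointLaw D ρ n₀ q, ∃ l m, p ∈ levelSet l m := by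
  rw [← map_killedLaw hq]
  have hm : MeasurableSet {p | ∃ l m, p ∈ levelSet l m} := by
    simp only [ofPred_exists]
    exact MeasurableSet.iUnion fun l => MeasurableSet.iUnion fun m => measurableSet_levelSet l m
  refine (ae_map_iff (measurable_id.prodMap measurable_path).aemeasurable hm).2 ?_
  filter_upwards [ae_killedLaw hq hreg] with z hz
  obtain ⟨l, hl⟩ := hz.exists_isLeast z.1
  exact ⟨l, _, (mem_levelSet_iff hz.rightCont z.1 l _).2 ⟨rfl, hl⟩⟩

/-- The conditional law of the height above the running infimum at an exponential time, in terms of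
the joint law of the time and the path. -/
lemma IsVersion.cond_eq {Ω : Type*} [MeasurableSpace Ω] {μ : Measure Ω} [IsProbabilityMeasure μ]
    {Q : ℝ≥0 → Ω → ℤ} (hQ : D.IsVersion ρ n₀ μ Q) (hq : 0 < q)
    (hreg : ∀ᵐ ω ∂D.driverLaw, Regular D ρ n₀ ω)
    {e : Ω → ℝ≥0} (he : HasLaw (fun ω => (e ω : ℝ)) (expMeasure q) μ)
    (heQ : IndepFun e (fun ω t => Q t ω) μ) (l k : ℤ) :
    μ {ω | runningInf Q (e ω) ω = l} = jointLaw D ρ n₀ q (⋃ m, levelSet l m) ∧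
    ProbabilityTheory.cond μ {ω | runningInf Q (e ω) ω = l}
        {ω | Q (e ω) ω - runningInf Q (e ω) ω = k} =
      (jointLaw D ρ n₀ q (⋃ m, levelSet l m))⁻¹ * jointLaw D ρ n₀ q (levelSet l (l + k)) := by
  have he1 : e = fun ω => Real.toNNReal (e ω : ℝ) := by ext ω; simp
  have hem : AEMeasurable e μ := by
    rw [he1]
    exact measurable_real_toNNReal.comp_aemeasurable he.aemeasurable
  have hemap : μ.map e = expNN q := by
    rw [expNN, ← he.map_eq, AEMeasurable.map_map_of_aemeasurable
      measurable_real_toNNReal.aemeasurable he.aemeasurable]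
    congr 1
  have hY : AEMeasurable (fun ω => (e ω, fun t => Q t ω)) μ := hem.prodMk hQ.hasLaw.aemeasurable
  have hYmap : μ.map (fun ω => (e ω, fun t => Q t ω)) = jointLaw D ρ n₀ q := by
    rw [(indepFun_iff_map_prod_eq_prod_map_map hem hQ.hasLaw.aemeasurable).1 heQ, hemap,
      hQ.hasLaw.map_eq, jointLaw]
  have hUm : MeasurableSet (⋃ m, levelSet l m) :=
    MeasurableSet.iUnion fun m => measurableSet_levelSet l m
  have hae : ∀ᵐ ω ∂μ, (∀ t, ContinuousWithinAt (fun s => Q s ω) (Ici t) t) ∧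
      ∃ l m, (e ω, fun t => Q t ω) ∈ levelSet l m := by
    have h1 : ∀ᵐ p ∂μ.map (fun ω => (e ω, fun t => Q t ω)), ∃ l m, p ∈ levelSet l m := by
      rw [hYmap]
      exact ae_jointLaw_mem_levelSet hq hreg
    filter_upwards [hQ.rightCont, ae_of_ae_map hY h1] with ω h2 h3
    exact ⟨h2, h3⟩
  -- Almost surely a least value is attained, so the `sInf` in `runningInf` is this value and not a
  -- default for an unbounded set.
  have hinf : ∀ᵐ ω ∂μ, ∃ l₀, runningInf Q (e ω) ω = l₀ ∧
      ∀ l m, (e ω, fun t => Q t ω) ∈ levelSet l m ↔ l = l₀ ∧ Q (e ω) ω = m := by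
    filter_upwards [hae] with ω ⟨h1, l₀, m₀, h2⟩
    have h3 := ((mem_levelSet_iff h1 _ _ _).1 h2).2
    refine ⟨l₀, h3.csInf_eq, fun l m => ?_⟩
    rw [mem_levelSet_iff h1]
    constructor
    · rintro ⟨h4, h5⟩
      exact ⟨h5.unique h3, h4⟩
    · rintro ⟨rfl, h4⟩
      exact ⟨h4, h3⟩
  have hs : {ω | runningInf Q (e ω) ω = l} =ᵐ[μ]
      (fun ω => (e ω, fun t => Q t ω)) ⁻¹' (⋃ m, levelSet l m) := by
    filter_upwards [hinf] with ω ⟨l₀, h1, h2⟩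
    refine eq_iff_iff.2 ?_
    change runningInf Q (e ω) ω = l ↔ (e ω, fun t => Q t ω) ∈ ⋃ m, levelSet l m
    simp only [mem_iUnion, h2, h1]
    exact ⟨fun h => ⟨_, h.symm, rfl⟩, fun ⟨_, h, _⟩ => h.symm⟩
  have hst : ({ω | Q (e ω) ω - runningInf Q (e ω) ω = k} ∩ {ω | runningInf Q (e ω) ω = l} : Set Ω)
      =ᵐ[μ] (fun ω => (e ω, fun t => Q t ω)) ⁻¹' levelSet l (l + k) := by
    filter_upwards [hinf] with ω ⟨l₀, h1, h2⟩
    refine eq_iff_iff.2 ?_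
    change (Q (e ω) ω - runningInf Q (e ω) ω = k ∧ runningInf Q (e ω) ω = l) ↔
      (e ω, fun t => Q t ω) ∈ levelSet l (l + k)
    rw [h2, h1]
    constructor
    · rintro ⟨h3, h4⟩
      exact ⟨h4.symm, by omega⟩
    · rintro ⟨h3, h4⟩
      exact ⟨by omega, h3.symm⟩
  have hs' : μ {ω | runningInf Q (e ω) ω = l} = jointLaw D ρ n₀ q (⋃ m, levelSet l m) := by
    rw [measure_congr hs, ← hYmap, Measure.map_apply_of_aemeasurable hY hUm]
  -- The infimum runs over uncountably many times and `Q` is only almost everywhere measurable, so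
  -- the conditioning event is shown to be null-measurable only.
  have hsm : NullMeasurableSet {ω | runningInf Q (e ω) ω = l} μ :=
    (hY.nullMeasurable hUm).congr hs.symm
  refine ⟨hs', ?_⟩
  rw [ProbabilityTheory.cond, Measure.smul_apply, smul_eq_mul, hs', Measure.restrict_apply₀' hsm,
    measure_congr hst, ← hYmap, Measure.map_apply_of_aemeasurable hY (measurableSet_levelSet _ _)]

/-- The probabilities of the levels at the exponential time, given that the minimum is zero, are
proportional to weights that are the same for all rules that agree above level zero. -/
def zeroWeight (D : Params) (q : ℝ) (m : ℤ) : ℝ≥0∞ :=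
  if m < 0 then 0 else if m = 0 then 1 else excursionRatio D q m

lemma jointLaw_levelSet_zero (hq : 0 < q) (hρ : AgreesAbove D ρ)
    (hreg : ∀ᵐ ω ∂D.driverLaw, Regular D ρ n₀ ω) (m : ℤ) :
    jointLaw D ρ n₀ q (levelSet 0 m) = zeroWeight D q m * jointLaw D ρ n₀ q (levelSet 0 0) := by
  unfold zeroWeight
  split_ifs with h1 h2
  · have h : levelSet 0 m = ∅ := by
      rw [eq_empty_iff_forall_notMem]
      rintro p ⟨-, h2, -⟩
      omega
    rw [h, measure_empty, zero_mul]
  · rw [h2, one_mul]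
  · rw [jointLaw_levelSet hq hreg, jointLaw_levelSet hq hreg]
    exact killedLaw_levelEvent_zero (by omega) hq hρ hreg

/-- Numerator and denominator are both multiples of the probability of being at level zero with
minimum zero. It cancels, and the right-hand side no longer mentions `ρ` or `n₀`. -/
lemma jointLaw_ratio_zero (hq : 0 < q) (hρ : AgreesAbove D ρ)
    (hreg : ∀ᵐ ω ∂D.driverLaw, Regular D ρ n₀ ω) [IsProbabilityMeasure (D.pathLaw ρ n₀)]
    (hpos : jointLaw D ρ n₀ q (⋃ m, levelSet 0 m) ≠ 0) (k : ℤ) :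
    (jointLaw D ρ n₀ q (⋃ m, levelSet 0 m))⁻¹ * jointLaw D ρ n₀ q (levelSet 0 k) =
      (∑' m, zeroWeight D q m)⁻¹ * zeroWeight D q k := by
  have := isProbabilityMeasure_expNN hq
  have hfin : jointLaw D ρ n₀ q (levelSet 0 0) ≠ ⊤ := by
    unfold jointLaw
    exact measure_ne_top _ _
  have hsum : jointLaw D ρ n₀ q (⋃ m, levelSet 0 m) =
      (∑' m, zeroWeight D q m) * jointLaw D ρ n₀ q (levelSet 0 0) := by
    rw [measure_iUnion (pairwise_disjoint_levelSet 0) (measurableSet_levelSet 0),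
      ← ENNReal.tsum_mul_right]
    exact tsum_congr fun m => jointLaw_levelSet_zero hq hρ hreg m
  -- If this mass vanished, every level with minimum zero would have mass zero, against `hpos`.
  have h0 : jointLaw D ρ n₀ q (levelSet 0 0) ≠ 0 := by
    intro h
    rw [hsum, h, mul_zero] at hpos
    exact hpos rfl
  rw [hsum, jointLaw_levelSet_zero hq hρ hreg k, ENNReal.mul_inv (Or.inr hfin) (Or.inr h0),
    mul_mul_mul_comm, mul_comm _ (zeroWeight D q k), ← mul_assoc]
  rw [mul_assoc, ENNReal.inv_mul_cancel h0 hfin, mul_one, mul_comm]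

end Versions

end PRP

end

/-! ### The theorem, for minimum zero and for positive minimum. -/

theorem theorem3p2 (D : PRP.Params) (n₀ : ℤ) (hn₀ : 0 ≤ n₀)
    (hQne : D.NonExplosive D.free n₀) (hRne : D.NonExplosive (D.reflected 0) n₀)
    {Ω : Type*} [MeasurableSpace Ω] (μ : Measure Ω) [IsProbabilityMeasure μ]
    (Q : ℝ≥0 → Ω → ℤ) (hQ : D.IsPRPSystem n₀ μ Q)
    {Ω₀ : Type*} [MeasurableSpace Ω₀] (μ₀ : Measure Ω₀) [IsProbabilityMeasure μ₀]
    (Q₀ : ℝ≥0 → Ω₀ → ℤ) (hQ₀ : D.IsReflectedPRPSystem 0 n₀ μ₀ Q₀)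
    (q : ℝ) (hq : 0 < q)
    (e : Ω → ℝ≥0) (he : HasLaw (fun ω => (e ω : ℝ)) (expMeasure q) μ)
    (heQ : IndepFun e (fun ω t => Q t ω) μ)
    (e₀ : Ω₀ → ℝ≥0) (he₀ : HasLaw (fun ω => (e₀ ω : ℝ)) (expMeasure q) μ₀)
    (heQ₀ : IndepFun e₀ (fun ω t => Q₀ t ω) μ₀)
    (l k : ℤ) (hl : 0 ≤ l) (hk : 1 ≤ k)
    (hpos : μ {ω | PRP.runningInf Q (e ω) ω = l} ≠ 0) :
    cond μ {ω | PRP.runningInf Q (e ω) ω = l}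
        {ω | Q (e ω) ω - PRP.runningInf Q (e ω) ω = k} =
      cond μ₀ {ω | PRP.runningInf Q₀ (e₀ ω) ω = l}
        {ω | Q₀ (e₀ ω) ω - PRP.runningInf Q₀ (e₀ ω) ω = k} := by
  have hfree := PRP.ae_regular (PRP.isInvariant_free D) (mem_univ n₀) hQne
  have hrefl := PRP.ae_regular (PRP.isInvariant_reflected D) hn₀ hRne
  obtain ⟨h1, h2⟩ := PRP.IsVersion.cond_eq hQ hq hfree he heQ l k
  obtain ⟨-, h3⟩ := PRP.IsVersion.cond_eq hQ₀ hq hrefl he₀ heQ₀ l k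
  rw [h1] at hpos
  rw [h2, h3]
  rcases hl.eq_or_lt with rfl | hl
  · have hp : ∀ ρ, IsProbabilityMeasure (D.pathLaw ρ n₀) := fun ρ =>
      Measure.isProbabilityMeasure_map PRP.measurable_path.aemeasurable
    -- Positivity is assumed for the free system only; the coupling transfers it to the reflection.
    have hpos' : PRP.jointLaw D (D.reflected 0) n₀ q (⋃ m, PRP.levelSet 0 m) ≠ 0 := by
      intro h
      apply hpos
      rw [PRP.jointLaw_iUnion_levelSet hq hrefl] at h
      rw [PRP.jointLaw_iUnion_levelSet hq hfree]
      exact le_antisymm (h ▸ PRP.killedLaw_minimum_zero_le hn₀ hq hrefl) zero_le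
    rw [zero_add, PRP.jointLaw_ratio_zero hq (PRP.agreesAbove_free D) hfree hpos,
      PRP.jointLaw_ratio_zero hq (PRP.agreesAbove_reflected D) hrefl hpos']
  · have heq : ∀ m, PRP.jointLaw D D.free n₀ q (PRP.levelSet l m) =
        PRP.jointLaw D (D.reflected 0) n₀ q (PRP.levelSet l m) := fun m => by
      rw [PRP.jointLaw_levelSet hq hfree, PRP.jointLaw_levelSet hq hrefl]
      exact PRP.killedLaw_levelEvent_pos hl m hq (PRP.agreesAbove_free D)
        (PRP.agreesAbove_reflected D) hfree hrefl
    -- Summation of `heq` over the final level shows that the conditioning events have equal mass as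
    -- well.
    rw [measure_iUnion (PRP.pairwise_disjoint_levelSet l) (PRP.measurableSet_levelSet l),
      measure_iUnion (PRP.pairwise_disjoint_levelSet l) (PRP.measurableSet_levelSet l)]
    simp_rw [heq]
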